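/- **Setting.** Let $\Omega\subset\mathbb R^2$ be a bounded polygonal domain (without slits) and let $\Gamma_D\subset\partial\Omega$ be a nonempty finite union of nondegenerate segments. Put $V=\{\mathbf u\in (H^1(\Omega))^2:\ \mathbf u=\mathbf 0\text{ on }\Gamma_D\}$ and $W=(L^2(\Omega))^3$. Let $\mathbf D$ be a constant symmetric positive definite $3\times3$ matrix. For $\mathbf v\in V$ let $\boldsymbol\epsilon[\mathbf v]=\mathbf B\mathbf v=(\partial_x v_1,\ \partial_y v_2,\ \partial_y v_1+\partial_x v_2)^T$ and $\boldsymbol\sigma[\mathbf v]=\mathbf D\mathbf B\mathbf v$. For $\boldsymbol\epsilon,\boldsymbol\sigma\in W$ put $|||\boldsymbol\epsilon|||_Y=(\int_\Omega \mathbf D\boldsymbol\epsilon:\boldsymbol\epsilon\,d\Omega)^{1/2}$ and $|||\boldsymbol\sigma|||_{Y^*}=(\int_\Omega \boldsymbol\sigma:\mathbf D^{-1}\boldsymbol\sigma\,d\Omega)^{1/2}$, where $:$ is the Euclidean inner product of $\mathbb R^3$. Let $f$ be a continuous linear functional on $V$. **Mesh and spaces.** Let $\mathcal T_h$ be a conforming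 mesh of $\Omega$ consisting of triangles or of strictly convex quadrilaterals. The center of an element is the average of its vertices, and joining the center to the vertices cuts an element into subtriangles, one for each edge. In the triangular case, $V_h$ is the space of all $\mathbf v\in V$ that are continuous on $\overline\Omega$ and affine on each element. In the quadrilateral case, $V_h$ is the space of all $\mathbf v\in V$ that are continuous on $\overline\Omega$ and affine on each subtriangle, and whose value at the center of each element is the average of the values at its four vertices. The subdivision $\mathcal T_{1,h}$ has one cell for each edge of $\mathcal T_h$, the union of the (one or two) subtriangles having that edge. The subdivision $\mathcal T_{2,h}$ consists of the quadrilaterals obtained by cutting each element along the segments from its center to the midpoints of its edges. For $k=1,2$ let $W_{k,h}\subset W$ be the fields that are constant on each cell of $\mathcal T_{k,h}$, and let $P_{k,h}:W\to W_{k,h}$ replace a field on each cell by its average over the cell. Put $\hat{\boldsymbol\epsilon}[\mathbf v]=P_{1,h}\mathbf B\mathbf v$ and $\bar{\boldsymbol\epsilon}[\mathbf v]=P_{2,h}P_{1,h}\mathbf B\mathbf v$. **Stability constant.** On $\Pi=V\times W\times W$ let $|||(\mathbf v,\boldsymbol\delta_1,\boldsymbol\delta_2)|||_\Pi^2=|||\mathbf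 B\mathbf v|||_Y^2+|||\boldsymbol\delta_1|||_Y^2+|||\boldsymbol\delta_2|||_Y^2$ and $|(\mathbf v,\boldsymbol\delta_1,\boldsymbol\delta_2)|_\Pi=|||\boldsymbol\delta_2|||_Y$. Let $$B\big((\mathbf v,\boldsymbol\delta_1,\boldsymbol\delta_2),(\boldsymbol\tau_1,\boldsymbol\tau_2)\big)=\int_\Omega\boldsymbol\tau_1:(\mathbf B\mathbf v-\boldsymbol\delta_1)\,d\Omega+\int_\Omega\boldsymbol\tau_2:(\boldsymbol\delta_1-\boldsymbol\delta_2)\,d\Omega .$$ Let $Z$ be the set of all $U\in\Pi$ with $B(U,Q)=0$ for all $Q\in W\times W$, and let $Z_h$ be the set of all $U\in V_h\times W_{1,h}\times W_{2,h}$ with $B(U,Q)=0$ for all $Q\in W_{1,h}\times W_{2,h}$. A number $\alpha>0$ is called a *stability constant* if $|U|_\Pi\ge\alpha\,|||U|||_\Pi$ for all $U\in Z\cup Z_h$. **Theorem.** Let $\mathbf u\in V$ and $\bar{\mathbf u}_h\in V_h$ satisfy $$\int_\Omega\mathbf D\boldsymbol\epsilon[\mathbf u]:\boldsymbol\epsilon[\mathbf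 v]\,d\Omega=f(\mathbf v)\quad\forall\mathbf v\in V,\qquad \int_\Omega\mathbf D\bar{\boldsymbol\epsilon}[\bar{\mathbf u}_h]:\bar{\boldsymbol\epsilon}[\mathbf v]\,d\Omega=f(\mathbf v)\quad\forall\mathbf v\in V_h .$$ Consider the estimate $$|||\boldsymbol\epsilon[\mathbf u]-\bar{\boldsymbol\epsilon}[\bar{\mathbf u}_h]|||_Y\le 2\inf_{\mathbf v\in V_h}|||\boldsymbol\epsilon[\mathbf u]-\bar{\boldsymbol\epsilon}[\mathbf v]|||_Y+C_B\Big(\inf_{\boldsymbol\tau_1\in W_{1,h}}|||\boldsymbol\sigma[\mathbf u]-\boldsymbol\tau_1|||_{Y^*}+\inf_{\boldsymbol\tau_2\in W_{2,h}}|||\boldsymbol\sigma[\mathbf u]-\boldsymbol\tau_2|||_{Y^*}\Big).\qquad(*)$$ 1. (Triangles.) For all $\mathbf D$ and $\kappa$ there is an $\alpha>0$, depending only on $\mathbf D$ and $\kappa$, that is a stability constant for every $\Omega$, $\Gamma_D$ and every triangular mesh each of whose elements $T$ contains a disk of some radius $r_T>0$ with $\operatorname{diam}T\le\kappa r_T$.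 (Hence, by 2, $(*)$ holds on all these meshes with one constant $C_B=2/\alpha$.) 2. (Triangles and quadrilaterals.) If $\alpha$ is a stability constant, then $(*)$ holds with $C_B=2/\alpha$, for all $f$, $\mathbf u$ and $\bar{\mathbf u}_h$. 3. (Triangles and quadrilaterals.) For every mesh there is a constant $C_B>0$, independent of $f$, $\mathbf u$ and $\bar{\mathbf u}_h$, for which $(*)$ holds. -/

import Mathlib

open MeasureTheory Set
open scoped ContDiff

noncomputable section

namespace SSE

/-- The Euclidean plane; it also serves as the space of values of displacement fields. -/
abbrev Plane := EuclideanSpace ℝ (Fin 2)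

/-- Symmetric `2 × 2` tensors in Voigt notation, with the Euclidean inner product of `ℝ³`. -/
abbrev Voigt := EuclideanSpace ℝ (Fin 3)

/-- Square integrable vector fields on `Ω`. -/
abbrev VecField (Ω : Set Plane) := Lp Plane 2 (volume.restrict Ω)

/-- The space `W = (L²(Ω))³` of strain and stress fields. -/
abbrev StrainField (Ω : Set Plane) := Lp Voigt 2 (volume.restrict Ω)

/-! ### Domain and displacement space -/

/-- A finite union of nondegenerate segments. -/
def IsPolygonal (Γ : Set Plane) : Prop :=
  ∃ S : Finset (Plane × Plane), S.Nonempty ∧ (∀ s ∈ S, s.1 ≠ s.2) ∧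
    Γ = ⋃ s ∈ S, segment ℝ s.1 s.2

/-- A bounded polygonal domain (connected open set) without slits, with a nonempty polygonal
Dirichlet part `ΓD` of its boundary. The Neumann part is `frontier Ω \ ΓD`. -/
structure IsElasticBody (Ω ΓD : Set Plane) : Prop where
  isOpen : IsOpen Ω
  isConnected : IsConnected Ω
  isBounded : Bornology.IsBounded Ω
  no_slit : interior (closure Ω) = Ω
  polygonal : IsPolygonal (frontier Ω)
  dirichlet_subset : ΓD ⊆ frontier Ω
  dirichlet : IsPolygonal ΓD

/-- The `i`-th unit vector of the plane. -/
def unitVec (i : Fin 2) : Plane := EuclideanSpace.single i 1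

/-- The integration by parts formulas `∫_Ω (∂ᵢ φ) u = - ∫_Ω φ gᵢ`, `i = 1, 2`, without boundary
term, for the pair `w = (u, (g₁, g₂))`. -/
def PartsFormula (Ω : Set Plane) (φ : Plane → ℝ) (w : VecField Ω × (Fin 2 → VecField Ω)) : Prop :=
  ∀ i, ∫ x in Ω, fderiv ℝ φ x (unitVec i) • w.1 x = - ∫ x in Ω, φ x • w.2 i x

/-- `w = (u, (g₁, g₂))` with `gᵢ` the weak partial derivative `∂ᵢ u` in `Ω`; that is,
`u ∈ (H¹(Ω))²` with weak gradient `(g₁, g₂)`. -/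
def IsWeakGradient (Ω : Set Plane) (w : VecField Ω × (Fin 2 → VecField Ω)) : Prop :=
  ∀ φ : Plane → ℝ, ContDiff ℝ ∞ φ → HasCompactSupport φ → tsupport φ ⊆ Ω → PartsFormula Ω φ w

/-- `u = 0` on `ΓD` for `u ∈ (H¹(Ω))²` with weak gradient `(g₁, g₂)`. By Green's formula
`∫_Ω (∂ᵢ φ) u + ∫_Ω φ (∂ᵢ u) = ∫_{∂Ω} φ u nᵢ`, the trace of `u` vanishes on `ΓD` if and only if
integration by parts produces no boundary term for every smooth compactly supported `φ` on the
plane that vanishes near the closure of the rest `frontier Ω \ ΓD` of the boundary. -/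
def VanishesOn (Ω ΓD : Set Plane) (w : VecField Ω × (Fin 2 → VecField Ω)) : Prop :=
  ∀ φ : Plane → ℝ, ContDiff ℝ ∞ φ → HasCompactSupport φ →
    Disjoint (tsupport φ) (closure (frontier Ω \ ΓD)) → PartsFormula Ω φ w

theorem integrable_smul_of_continuous {Ω : Set Plane} {φ : Plane → ℝ} (hφ : Continuous φ)
    (hc : HasCompactSupport φ) (u : VecField Ω) :
    Integrable (fun x => φ x • u x) (volume.restrict Ω) := by
  have h1 : MemLp φ 2 (volume.restrict Ω) := (hφ.memLp_of_hasCompactSupport hc).restrict Ω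
  have h2 : MemLp u 2 (volume.restrict Ω) := Lp.memLp u
  exact memLp_one_iff_integrable.1 (h2.smul h1)

theorem integrable_fderiv_smul {Ω : Set Plane} {φ : Plane → ℝ} (hφ : ContDiff ℝ ∞ φ)
    (hc : HasCompactSupport φ) (v : Plane) (u : VecField Ω) :
    Integrable (fun x => fderiv ℝ φ x v • u x) (volume.restrict Ω) :=
  integrable_smul_of_continuous ((hφ.continuous_fderiv (by simp)).clm_apply continuous_const)
    (hc.fderiv_apply (𝕜 := ℝ) v) u

theorem PartsFormula.add {Ω : Set Plane} {φ : Plane → ℝ} (hφ : ContDiff ℝ ∞ φ)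
    (hc : HasCompactSupport φ) {w z : VecField Ω × (Fin 2 → VecField Ω)}
    (hw : PartsFormula Ω φ w) (hz : PartsFormula Ω φ z) : PartsFormula Ω φ (w + z) := by
  intro i
  have e1 : ∫ x in Ω, fderiv ℝ φ x (unitVec i) • (w + z).1 x
      = ∫ x in Ω, (fderiv ℝ φ x (unitVec i) • w.1 x + fderiv ℝ φ x (unitVec i) • z.1 x) := by
    refine integral_congr_ae ?_
    filter_upwards [Lp.coeFn_add w.1 z.1] with x hx
    rw [Prod.fst_add, hx, Pi.add_apply, smul_add]
  have e2 : ∫ x in Ω, φ x • (w + z).2 i x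
      = ∫ x in Ω, (φ x • w.2 i x + φ x • z.2 i x) := by
    refine integral_congr_ae ?_
    filter_upwards [Lp.coeFn_add (w.2 i) (z.2 i)] with x hx
    rw [Prod.snd_add, Pi.add_apply, hx, Pi.add_apply, smul_add]
  rw [e1, e2, integral_add (integrable_fderiv_smul hφ hc _ _) (integrable_fderiv_smul hφ hc _ _),
    integral_add (integrable_smul_of_continuous hφ.continuous hc _)
      (integrable_smul_of_continuous hφ.continuous hc _), hw i, hz i, neg_add]

theorem PartsFormula.smul {Ω : Set Plane} {φ : Plane → ℝ} (c : ℝ)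
    {w : VecField Ω × (Fin 2 → VecField Ω)} (hw : PartsFormula Ω φ w) :
    PartsFormula Ω φ (c • w) := by
  intro i
  have e1 : ∫ x in Ω, fderiv ℝ φ x (unitVec i) • (c • w).1 x
      = ∫ x in Ω, c • (fderiv ℝ φ x (unitVec i) • w.1 x) := by
    refine integral_congr_ae ?_
    filter_upwards [Lp.coeFn_smul c w.1] with x hx
    rw [Prod.smul_fst, hx, Pi.smul_apply, smul_comm]
  have e2 : ∫ x in Ω, φ x • (c • w).2 i x = ∫ x in Ω, c • (φ x • w.2 i x) := by
    refine integral_congr_ae ?_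
    filter_upwards [Lp.coeFn_smul c (w.2 i)] with x hx
    rw [Prod.smul_snd, Pi.smul_apply, hx, Pi.smul_apply, smul_comm]
  rw [e1, e2, integral_smul, integral_smul, hw i, smul_neg]

theorem PartsFormula.zero {Ω : Set Plane} {φ : Plane → ℝ} : PartsFormula Ω φ 0 := by
  intro i
  have e0 : ∀ᵐ x ∂(volume.restrict Ω), (0 : VecField Ω) x = 0 := Lp.coeFn_zero _ _ _
  have e1 : ∫ x in Ω, fderiv ℝ φ x (unitVec i) • (0 : VecField Ω × (Fin 2 → VecField Ω)).1 x
      = 0 := by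
    refine integral_eq_zero_of_ae ?_
    filter_upwards [e0] with x hx
    exact (congrArg _ hx).trans (smul_zero _)
  have e2 : ∫ x in Ω, φ x • (0 : VecField Ω × (Fin 2 → VecField Ω)).2 i x = 0 := by
    refine integral_eq_zero_of_ae ?_
    filter_upwards [e0] with x hx
    exact (congrArg _ hx).trans (smul_zero _)
  rw [e1, e2, neg_zero]

/-- The space `V = {u ∈ (H¹(Ω))² : u = 0 on ΓD}`. An element is stored together with its weak
gradient (which it determines), so that `V` carries a norm equivalent to the `H¹` norm. -/
def dispSpace (Ω ΓD : Set Plane) : Submodule ℝ (VecField Ω × (Fin 2 → VecField Ω)) where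
  carrier := {w | IsWeakGradient Ω w ∧ VanishesOn Ω ΓD w}
  zero_mem' := ⟨fun _ _ _ _ => PartsFormula.zero, fun _ _ _ _ => PartsFormula.zero⟩
  add_mem' := fun ha hb =>
    ⟨fun φ h1 h2 h3 => (ha.1 φ h1 h2 h3).add h1 h2 (hb.1 φ h1 h2 h3),
      fun φ h1 h2 h3 => (ha.2 φ h1 h2 h3).add h1 h2 (hb.2 φ h1 h2 h3)⟩
  smul_mem' := fun c _ ha =>
    ⟨fun φ h1 h2 h3 => (ha.1 φ h1 h2 h3).smul c, fun φ h1 h2 h3 => (ha.2 φ h1 h2 h3).smul c⟩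

/-- The columns of the matrix `B = [∂x 0; 0 ∂y; ∂y ∂x]`, split as `B = B₀ ∂x + B₁ ∂y`. -/
def strainMatrix : Fin 2 → Matrix (Fin 3) (Fin 2) ℝ :=
  ![!![1, 0; 0, 0; 0, 1], !![0, 0; 0, 1; 1, 0]]

/-- The matrix `B₀` or `B₁` as a continuous linear map. -/
def strainMap (i : Fin 2) : Plane →L[ℝ] Voigt :=
  LinearMap.toContinuousLinearMap (Matrix.toLpLin 2 2 (strainMatrix i))

/-- The strain `ε[u] = B u` of a displacement field. -/
def strain {Ω ΓD : Set Plane} (u : dispSpace Ω ΓD) : StrainField Ω :=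
  ∑ i, (strainMap i).compLp (u.1.2 i)

/-- Pointwise application of a constant `3 × 3` matrix to a field. -/
def applyMatrix {Ω : Set Plane} (A : Matrix (Fin 3) (Fin 3) ℝ) (ε : StrainField Ω) :
    StrainField Ω :=
  (Matrix.toEuclideanCLM (𝕜 := ℝ) A).compLp ε

/-- The stress `σ[u] = D B u` of a displacement field. -/
def stress (D : Matrix (Fin 3) (Fin 3) ℝ) {Ω ΓD : Set Plane} (u : dispSpace Ω ΓD) :
    StrainField Ω :=
  applyMatrix D (strain u)

/-- `∫_Ω σ : ε`. -/
def pairing {Ω : Set Plane} (σ ε : StrainField Ω) : ℝ := ∫ x in Ω, inner ℝ (σ x) (ε x)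

/-- The energy norm of a strain field, `(∫_Ω D ε : ε)^{1/2}`. -/
def normY (D : Matrix (Fin 3) (Fin 3) ℝ) {Ω : Set Plane} (ε : StrainField Ω) : ℝ :=
  √(pairing (applyMatrix D ε) ε)

/-- The energy norm of a stress field, `(∫_Ω σ : D⁻¹ σ)^{1/2}`. -/
def normYDual (D : Matrix (Fin 3) (Fin 3) ℝ) {Ω : Set Plane} (σ : StrainField Ω) : ℝ :=
  √(pairing σ (applyMatrix D⁻¹ σ))

/-! ### Piecewise constant fields and piecewise averaging -/

/-- A finite collection of compact cells in the plane. -/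
structure Cells where
  cells : Finset (Set Plane)
  compact : ∀ K ∈ cells, IsCompact K

/-- The fields in `W` that are constant (almost everywhere) on each cell. -/
def Cells.pwConst (𝒯 : Cells) (Ω : Set Plane) : Set (StrainField Ω) :=
  {ε | ∀ K ∈ 𝒯.cells, ∃ c : Voigt, ∀ᵐ x ∂(volume.restrict Ω), x ∈ K → ε x = c}

/-- The piecewise smoothing operator: on each cell `K` the field is replaced by its average
`|K|⁻¹ ∫_K ε`. (The cells used below cover `Ω` and overlap in null sets only.) -/
def Cells.average (𝒯 : Cells) {Ω : Set Plane} (ε : StrainField Ω) : StrainField Ω :=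
  ∑ K ∈ 𝒯.cells.attach,
    indicatorConstLp 2 (𝒯.compact K.1 K.2).measurableSet
      ((Measure.restrict_apply_le Ω K.1).trans_lt (𝒯.compact K.1 K.2).measure_lt_top).ne
      (⨍ x in K.1, ε x ∂(volume.restrict Ω))

/-! ### Meshes -/

/-- The cross product of two plane vectors. -/
def cross (a b : Plane) : ℝ := a 0 * b 1 - a 1 * b 0

section Element

variable {n : ℕ} [NeZero n]

/-- The closed polygon with vertices `T 0, …, T (n - 1)` (in convex position). -/
def cell (T : Fin n → Plane) : Set Plane := convexHull ℝ (range T)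

/-- The center of an element, the average of its vertices: the centroid of a triangle and the
point `r = s = 0` of a quadrilateral. -/
def center (T : Fin n → Plane) : Plane := (n : ℝ)⁻¹ • ∑ i, T i

/-- The subtriangle spanned by the center and the `i`-th edge. -/
def subTriangle (T : Fin n → Plane) (i : Fin n) : Set Plane :=
  convexHull ℝ {center T, T i, T (i + 1)}

/-- The quadrilateral with the vertices `center T`, midpoint of the `(i-1)`-st edge, `T i`, and
midpoint of the `i`-th edge, written as the union of its two halves along the diagonal from
`center T` to `T i`. -/
def vertexCell (T : Fin n → Plane) (i : Fin n) : Set Plane :=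
  convexHull ℝ {center T, midpoint ℝ (T (i - 1)) (T i), T i} ∪
    convexHull ℝ {center T, T i, midpoint ℝ (T i) (T (i + 1))}

/-- The polygon is strictly convex, nondegenerate, and its vertices are numbered
counterclockwise: all other vertices lie strictly to the left of each edge. -/
def IsConvexCCW (T : Fin n → Plane) : Prop :=
  ∀ i j, j ≠ i → j ≠ i + 1 → 0 < cross (T (i + 1) - T i) (T j - T i)

/-- The `i`-th edge of `T` is the `j`-th edge of `T'` (with the opposite orientation). -/
def SharesEdge (T T' : Fin n → Plane) (i j : Fin n) : Prop :=
  T i = T' (j + 1) ∧ T (i + 1) = T' j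

end Element

/-- A conforming mesh of `Ω` by strictly convex `n`-gons, `n = 3` or `n = 4`: the elements cover
the closure of `Ω`, and two distinct elements are disjoint or meet in exactly one common vertex
or in exactly one common edge. -/
structure Mesh (n : ℕ) [NeZero n] (Ω : Set Plane) where
  elems : Finset (Fin n → Plane)
  convex : ∀ T ∈ elems, IsConvexCCW T
  cover : ⋃ T ∈ elems, cell T = closure Ω
  conforming : ∀ T ∈ elems, ∀ T' ∈ elems, T ≠ T' →
    cell T ∩ cell T' = ∅ ∨
    (∃ i j, T i = T' j ∧ cell T ∩ cell T' = {T i}) ∨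
    (∃ i j, SharesEdge T T' i j ∧ cell T ∩ cell T' = segment ℝ (T i) (T (i + 1)))

namespace Mesh

variable {n : ℕ} [NeZero n] {Ω : Set Plane} (M : Mesh n Ω)

/-- Shape regularity with constant `κ`: every element contains a disk of radius `r > 0` with
`diam T ≤ κ r`. -/
def ShapeRegular (κ : ℝ) : Prop :=
  ∀ T ∈ M.elems, ∃ z : Plane, ∃ r > 0, Metric.closedBall z r ⊆ cell T ∧
    Metric.diam (cell T) ≤ κ * r

/-- The smoothing cell of the `i`-th edge `e` of `T`. If `e` is shared with an element `T'`, it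
is the quadrilateral whose vertices are the endpoints of `e` and the centers of `T` and `T'`,
that is, the union of the two subtriangles at `e`; if `e` is a boundary edge, it is the
subtriangle of `T` at `e`. -/
def edgeCell (T : Fin n → Plane) (i : Fin n) : Set Plane :=
  subTriangle T i ∪ ⋃ T' ∈ M.elems, ⋃ j ∈ {j | SharesEdge T T' i j}, subTriangle T' j

theorem isCompact_edgeCell (T : Fin n → Plane) (i : Fin n) : IsCompact (M.edgeCell T i) := by
  refine ((Set.toFinite _).isCompact_convexHull ℝ).union ?_
  exact (M.elems.finite_toSet).isCompact_biUnion fun T' _ =>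
    (Set.toFinite _).isCompact_biUnion fun j _ => (Set.toFinite _).isCompact_convexHull ℝ

open scoped Classical in
/-- The subdivision `𝒯₁`: one cell for each edge of the mesh. -/
def edgeMesh : Cells where
  cells := (M.elems ×ˢ Finset.univ).image fun p => M.edgeCell p.1 p.2
  compact := by
    intro K hK
    obtain ⟨p, _, rfl⟩ := Finset.mem_image.1 hK
    exact M.isCompact_edgeCell p.1 p.2

open scoped Classical in
/-- The subdivision `𝒯₂`: every element is cut along the segments from its center to the
midpoints of its edges, which gives one cell for each vertex of each element. -/
def vertexMesh : Cells where
  cells := (M.elems ×ˢ Finset.univ).image fun p => vertexCell p.1 p.2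
  compact := by
    intro K hK
    obtain ⟨p, _, rfl⟩ := Finset.mem_image.1 hK
    exact ((Set.toFinite _).isCompact_convexHull ℝ).union
      ((Set.toFinite _).isCompact_convexHull ℝ)

/-- `W_{1,h}`. -/
def W1 : Set (StrainField Ω) := M.edgeMesh.pwConst Ω

/-- `W_{2,h}`. -/
def W2 : Set (StrainField Ω) := M.vertexMesh.pwConst Ω

/-- The twice-projected strain `P_{2,h} P_{1,h} B v`. -/
def smoothedStrain {ΓD : Set Plane} (v : dispSpace Ω ΓD) : StrainField Ω :=
  M.vertexMesh.average (M.edgeMesh.average (strain v))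

end Mesh

/-- `p` is on `K` a polynomial of degree at most one. -/
def IsAffineOn (p : Plane → Plane) (K : Set Plane) : Prop :=
  ∃ A : Plane →ᵃ[ℝ] Plane, EqOn p A K

namespace Mesh

variable {n : ℕ} [NeZero n] {Ω : Set Plane} (M : Mesh n Ω)

/-- Membership of a continuous function in the finite element space. Triangles (`n = 3`): affine
on each element. Quadrilaterals (`n = 4`): affine on each of the four subtriangles of each
element, the value at the center being the average of the values at the four vertices. -/
def IsFEFunction (p : Plane → Plane) : Prop :=
  (n = 3 → ∀ T ∈ M.elems, IsAffineOn p (cell T)) ∧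
  (n = 4 → ∀ T ∈ M.elems, (∀ i, IsAffineOn p (subTriangle T i)) ∧
    p (center T) = (1 / 4 : ℝ) • ∑ i, p (T i))

/-- The discrete displacement space `V_h ⊆ V`: the elements of `V` with a representative that is
continuous on the closure of `Ω` and belongs to the finite element space. -/
def discSpace (ΓD : Set Plane) : Set (dispSpace Ω ΓD) :=
  {v | ∃ p : Plane → Plane, ContinuousOn p (closure Ω) ∧ M.IsFEFunction p ∧
    ∀ᵐ x ∂(volume.restrict Ω), v.1.1 x = p x}

end Mesh

/-! ### The mixed formulation and the stability assumption -/

section Mixed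

variable (D : Matrix (Fin 3) (Fin 3) ℝ) {n : ℕ} [NeZero n] {Ω ΓD : Set Plane}

/-- The norm on `Π = V × W × W`. -/
def normPi (U : dispSpace Ω ΓD × StrainField Ω × StrainField Ω) : ℝ :=
  √(normY D (strain U.1) ^ 2 + normY D U.2.1 ^ 2 + normY D U.2.2 ^ 2)

/-- The seminorm on `Π = V × W × W`. -/
def seminormPi (U : dispSpace Ω ΓD × StrainField Ω × StrainField Ω) : ℝ := normY D U.2.2

/-- `B((v, δ₁, δ₂), (τ₁, τ₂)) = ∫_Ω τ₁ : (B v - δ₁) + ∫_Ω τ₂ : (δ₁ - δ₂)`. -/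
def formB (V : dispSpace Ω ΓD × StrainField Ω × StrainField Ω)
    (Q : StrainField Ω × StrainField Ω) : ℝ :=
  pairing Q.1 (strain V.1 - V.2.1) + pairing Q.2 (V.2.1 - V.2.2)

/-- The kernel `Z` of `B(·, ·)`. -/
def kernelZ (Ω ΓD : Set Plane) : Set (dispSpace Ω ΓD × StrainField Ω × StrainField Ω) :=
  {V | ∀ Q, formB V Q = 0}

/-- The discrete kernel `Z_h` for `Π_h = V_h × W_{1,h} × W_{2,h}`,
`Δ_h = W_{1,h} × W_{2,h}`. -/
def discKernelZ (M : Mesh n Ω) (ΓD : Set Plane) :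
    Set (dispSpace Ω ΓD × StrainField Ω × StrainField Ω) :=
  {V | (V.1 ∈ M.discSpace ΓD ∧ V.2.1 ∈ M.W1 ∧ V.2.2 ∈ M.W2) ∧
    ∀ Q : StrainField Ω × StrainField Ω, Q.1 ∈ M.W1 → Q.2 ∈ M.W2 → formB V Q = 0}

/-- The stability assumption with constant `α`: the seminorm bounds `α` times the norm on
`Z ∪ Z_h`. -/
def StabilityAssumption (M : Mesh n Ω) (ΓD : Set Plane) (α : ℝ) : Prop :=
  ∀ U ∈ kernelZ Ω ΓD ∪ discKernelZ M ΓD, α * normPi D U ≤ seminormPi D U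

/-- `u` solves the weak elasticity problem `∫_Ω D ε[u] : ε[v] = f(v)` for all `v ∈ V`. -/
def SolvesWeak (f : dispSpace Ω ΓD →L[ℝ] ℝ) (u : dispSpace Ω ΓD) : Prop :=
  ∀ v, pairing (applyMatrix D (strain u)) (strain v) = f v

/-- `uh ∈ V_h` solves the twice-projected form of the strain-smoothed element method. -/
def SolvesSSE (M : Mesh n Ω) (f : dispSpace Ω ΓD →L[ℝ] ℝ) (uh : dispSpace Ω ΓD) : Prop :=
  uh ∈ M.discSpace ΓD ∧ ∀ v ∈ M.discSpace ΓD,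
    pairing (applyMatrix D (M.smoothedStrain uh)) (M.smoothedStrain v) = f v

/-- The error estimate with constant `C` for the exact displacement `u` and the discrete
displacement `uh`. -/
def ErrorEstimate (M : Mesh n Ω) (u uh : dispSpace Ω ΓD) (C : ℝ) : Prop :=
  normY D (strain u - M.smoothedStrain uh) ≤
    2 * (⨅ v : M.discSpace ΓD, normY D (strain u - M.smoothedStrain v.1)) +
    C * ((⨅ τ : M.W1, normYDual D (stress D u - τ.1)) +
      (⨅ τ : M.W2, normYDual D (stress D u - τ.1)))

end Mixed

end SSE

end

noncomputable section

namespace SSE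

/-! Error estimate. Averaging over the cells of a partition is the orthogonal projection onto the
piecewise constant fields, in `L²` and also in the energy product, since a constant matrix preserves
piecewise constancy. Write `ε` for the exact strain, `δ` and `δ'` for the smoothed strains of the
discrete solution and of a competitor, and let `η` be the strain of some `w` in `V_h` whose smoothed
strain `P₂P₁η` has energy distance zero from `δ - δ'`. Both weak problems, tested with `w`, give
`(Dδ, P₂P₁η) = (Dε, η)`. Hence the squared energy norm of `δ - δ'` is `(D(ε - δ'), δ - δ')` plus the
consistency terms `(Dε, η - P₁η)` and `(Dε, P₁η - P₂P₁η)`. By orthogonality a piecewise constant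
stress may be subtracted from `Dε` in each consistency term, so Cauchy-Schwarz produces the best
approximation errors times the norm of `η`. All that is needed is that norm of `η` is at most `C`
times that of `δ - δ'` (`normY_sub_le_of_lift`).

Such a `w` is found in two ways. Under the stability assumption the difference of the discrete
functions itself will do, because it generates an element of `Z_h`. On an arbitrary mesh the
smoothed strains lie in a finite-dimensional space, so a linear section of the smoothing map,
automatically bounded after composition with the strain, supplies `w` (`exists_lift`); the smoothing
map need not be injective.

Stability on triangles. The strain is a constant tensor `e` on each triangle. Its normal component
along an edge depends only on the displacements of the two endpoints, so it is the same on both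
sides of the edge and survives the averaging over the edge cell: `e` and the edge average `aᵢ` have
equal normal strains along edge `i` (`normalStrain_edgeCell_average`). The second averaging gives
`bᵢ = (aᵢ₋₁ + aᵢ) / 2`, as the centroid and the edge midpoints cut a triangle into six pieces of
equal area. A cycle of odd length three allows the `aᵢ` to be recovered from the `bᵢ`, and three
normal strains along the edges determine `e`, with a bound controlled by shape regularity
(`norm_sq_le_of_normalStrain_eq`). Summation over the elements bounds the strain by the smoothed
strain. On `Z` both auxiliary strains equal the strain, and on `Z_h` they are its two successive
averages. -/

open scoped MatrixOrder Matrix.Norms.L2Operator in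
theorem exists_eq_transpose_mul_self {D : Matrix (Fin 3) (Fin 3) ℝ} (hD : D.PosDef) :
    ∃ S : Matrix (Fin 3) (Fin 3) ℝ, D = S.transpose * S := by
  obtain ⟨S, hS⟩ := CStarAlgebra.nonneg_iff_eq_star_mul_self.1 hD.posSemidef.nonneg
  exact ⟨S, hS.trans (by rw [Matrix.star_eq_conjTranspose, Matrix.conjTranspose_eq_transpose_of_trivial])⟩

variable {Ω ΓD : Set Plane}

theorem pairing_eq_inner (σ ε : StrainField Ω) : pairing σ ε = inner ℝ σ ε :=
  (L2.inner_def σ ε).symm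

/-- `applyMatrix` as a continuous linear map. -/
def applyMatrixL (Ω : Set Plane) (A : Matrix (Fin 3) (Fin 3) ℝ) :
    StrainField Ω →L[ℝ] StrainField Ω :=
  (Matrix.toEuclideanCLM (𝕜 := ℝ) A).compLpL 2 (volume.restrict Ω)

theorem applyMatrixL_apply (A : Matrix (Fin 3) (Fin 3) ℝ) (ε : StrainField Ω) :
    applyMatrixL Ω A ε = applyMatrix A ε := rfl

theorem coeFn_applyMatrix (A : Matrix (Fin 3) (Fin 3) ℝ) (ε : StrainField Ω) :
    ∀ᵐ x ∂(volume.restrict Ω), applyMatrix A ε x = Matrix.toEuclideanCLM (𝕜 := ℝ) A (ε x) :=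
  ContinuousLinearMap.coeFn_compLp _ _

theorem applyMatrix_mul (A B : Matrix (Fin 3) (Fin 3) ℝ) (ε : StrainField Ω) :
    applyMatrix (A * B) ε = applyMatrix A (applyMatrix B ε) := by
  apply Lp.ext
  filter_upwards [coeFn_applyMatrix (A * B) ε, coeFn_applyMatrix A (applyMatrix B ε),
    coeFn_applyMatrix B ε] with x h1 h2 h3
  rw [h1, h2, h3, map_mul]
  rfl

theorem applyMatrix_one (ε : StrainField Ω) : applyMatrix 1 ε = ε := by
  apply Lp.ext
  filter_upwards [coeFn_applyMatrix 1 ε] with x h1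
  rw [h1, map_one]
  rfl

theorem applyMatrix_sub (A : Matrix (Fin 3) (Fin 3) ℝ) (ε δ : StrainField Ω) :
    applyMatrix A (ε - δ) = applyMatrix A ε - applyMatrix A δ :=
  map_sub (applyMatrixL Ω A) ε δ

theorem pairing_applyMatrix_transpose (A : Matrix (Fin 3) (Fin 3) ℝ) (σ ε : StrainField Ω) :
    pairing (applyMatrix A.transpose σ) ε = pairing σ (applyMatrix A ε) := by
  refine integral_congr_ae ?_
  filter_upwards [coeFn_applyMatrix A.transpose σ, coeFn_applyMatrix A ε] with x h1 h2
  rw [h1, h2, ← Matrix.conjTranspose_eq_transpose_of_trivial, ← Matrix.star_eq_conjTranspose,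
    map_star, ContinuousLinearMap.star_eq_adjoint, ContinuousLinearMap.adjoint_inner_left]

theorem pairing_transpose_mul (S : Matrix (Fin 3) (Fin 3) ℝ) (σ ε : StrainField Ω) :
    pairing (applyMatrix (S.transpose * S) σ) ε
      = inner ℝ (applyMatrix S σ) (applyMatrix S ε) := by
  rw [applyMatrix_mul, pairing_applyMatrix_transpose, pairing_eq_inner]

/-! ### Energy norms -/

section Energy

variable {D S : Matrix (Fin 3) (Fin 3) ℝ}

/-- The factorization `D = SᵀS` turns the energy norm into the Hilbert space norm of `Sε`, from
which the triangle and Cauchy-Schwarz inequalities are inherited. -/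
theorem normY_eq_norm (hS : D = S.transpose * S) (ε : StrainField Ω) :
    normY D ε = ‖applyMatrix S ε‖ := by
  rw [normY, hS, pairing_transpose_mul, real_inner_self_eq_norm_sq, Real.sqrt_sq (norm_nonneg _)]

theorem normY_nonneg (ε : StrainField Ω) : 0 ≤ normY D ε := Real.sqrt_nonneg _

theorem normY_zero : normY D (0 : StrainField Ω) = 0 := by
  rw [normY, pairing_eq_inner, inner_zero_right, Real.sqrt_zero]

theorem normYDual_nonneg (σ : StrainField Ω) : 0 ≤ normYDual D σ := Real.sqrt_nonneg _

theorem normY_sq (hD : D.PosDef) (ε : StrainField Ω) :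
    normY D ε ^ 2 = pairing (applyMatrix D ε) ε := by
  obtain ⟨S, hS⟩ := exists_eq_transpose_mul_self hD
  rw [normY_eq_norm hS, hS, pairing_transpose_mul, real_inner_self_eq_norm_sq]

theorem normY_add_le (hD : D.PosDef) (ε δ : StrainField Ω) :
    normY D (ε + δ) ≤ normY D ε + normY D δ := by
  obtain ⟨S, hS⟩ := exists_eq_transpose_mul_self hD
  simp only [normY_eq_norm hS, ← applyMatrixL_apply, map_add]
  exact norm_add_le _ _

theorem normY_sub_comm (hD : D.PosDef) (ε δ : StrainField Ω) :
    normY D (ε - δ) = normY D (δ - ε) := by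
  obtain ⟨S, hS⟩ := exists_eq_transpose_mul_self hD
  simp only [normY_eq_norm hS, applyMatrix_sub]
  exact norm_sub_rev _ _

theorem pairing_applyMatrix_le (hD : D.PosDef) (ε δ : StrainField Ω) :
    pairing (applyMatrix D ε) δ ≤ normY D ε * normY D δ := by
  obtain ⟨S, hS⟩ := exists_eq_transpose_mul_self hD
  simp only [normY_eq_norm hS]
  rw [hS, pairing_transpose_mul]
  exact real_inner_le_norm _ _

theorem applyMatrix_mul_inv (hD : D.PosDef) (σ : StrainField Ω) :
    applyMatrix D (applyMatrix D⁻¹ σ) = σ := by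
  rw [← applyMatrix_mul, Matrix.mul_nonsing_inv _ ((Matrix.isUnit_iff_isUnit_det _).1 hD.isUnit),
    applyMatrix_one]

theorem pairing_le_normYDual_mul (hD : D.PosDef) (σ ε : StrainField Ω) :
    pairing σ ε ≤ normYDual D σ * normY D ε := by
  have h : normYDual D σ = normY D (applyMatrix D⁻¹ σ) := by
    rw [normYDual, normY, applyMatrix_mul_inv hD]
  rw [h]
  conv_lhs => rw [← applyMatrix_mul_inv hD σ]
  exact pairing_applyMatrix_le hD _ _

/-- The matrix acts pointwise, so its operator norm is a constant valid for all domains at once;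
this uniformity is what makes the stability constant independent of `Ω`. -/
theorem normY_le_norm (D : Matrix (Fin 3) (Fin 3) ℝ) (hD : D.PosDef) :
    ∃ c, 0 < c ∧ ∀ (Ω : Set Plane) (ε : StrainField Ω), normY D ε ≤ c * ‖ε‖ := by
  obtain ⟨S, hS⟩ := exists_eq_transpose_mul_self hD
  refine ⟨‖Matrix.toEuclideanCLM (𝕜 := ℝ) S‖ + 1, by positivity, fun Ω ε => ?_⟩
  rw [normY_eq_norm hS]
  refine (ContinuousLinearMap.norm_compLp_le _ _).trans ?_
  gcongr
  linarith

theorem norm_le_normY (D : Matrix (Fin 3) (Fin 3) ℝ) (hD : D.PosDef) :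
    ∃ c, 0 < c ∧ ∀ (Ω : Set Plane) (ε : StrainField Ω), ‖ε‖ ≤ c * normY D ε := by
  obtain ⟨S, hS⟩ := exists_eq_transpose_mul_self hD
  refine ⟨‖Matrix.toEuclideanCLM (𝕜 := ℝ) S⁻¹‖ + 1, by positivity, fun Ω ε => ?_⟩
  have hu : IsUnit S.det := by
    have h := (Matrix.isUnit_iff_isUnit_det _).1 hD.isUnit
    rw [hS, Matrix.det_mul] at h
    exact (IsUnit.mul_iff.1 h).2
  have h1 : ε = applyMatrix S⁻¹ (applyMatrix S ε) := by
    rw [← applyMatrix_mul, Matrix.nonsing_inv_mul _ hu, applyMatrix_one]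
  rw [normY_eq_norm hS]
  conv_lhs => rw [h1]
  refine (ContinuousLinearMap.norm_compLp_le _ _).trans ?_
  gcongr
  linarith

end Energy

/-! ### Averaging over a partition as an orthogonal projection -/

section Averaging

variable {𝒯 : Cells}

/-- The cells cover almost all of `Ω` and overlap in null sets only. -/
structure Cells.IsPartition (𝒯 : Cells) (Ω : Set Plane) : Prop where
  aedisjoint : ∀ K ∈ 𝒯.cells, ∀ L ∈ 𝒯.cells, K ≠ L → AEDisjoint (volume.restrict Ω) K L
  cover : ∀ᵐ x ∂(volume.restrict Ω), ∃ K ∈ 𝒯.cells, x ∈ K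

theorem measure_restrict_ne_top (Ω : Set Plane) {K : Set Plane} (hK : IsCompact K) :
    volume.restrict Ω K ≠ ⊤ :=
  ((Measure.restrict_apply_le Ω K).trans_lt hK.measure_lt_top).ne

/-- The field with the value `c K` on the cell `K`. -/
def Cells.piecewise (𝒯 : Cells) (Ω : Set Plane) :
    ({K // K ∈ 𝒯.cells} → Voigt) →ₗ[ℝ] StrainField Ω where
  toFun c := ∑ K, indicatorConstLp 2 (𝒯.compact K.1 K.2).measurableSet
    (measure_restrict_ne_top Ω (𝒯.compact K.1 K.2)) (c K)
  map_add' c d := by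
    rw [← Finset.sum_add_distrib]
    exact Finset.sum_congr rfl fun K _ => indicatorConstLp_add.symm
  map_smul' r c := by
    rw [RingHom.id_apply, Finset.smul_sum]
    refine Finset.sum_congr rfl fun K _ => ?_
    rw [Pi.smul_apply]
    apply Lp.ext
    filter_upwards [indicatorConstLp_coeFn (μ := volume.restrict Ω) (p := 2)
      (hs := (𝒯.compact K.1 K.2).measurableSet)
      (hμs := measure_restrict_ne_top Ω (𝒯.compact K.1 K.2)) (c := r • c K),
      Lp.coeFn_smul r (indicatorConstLp 2 (𝒯.compact K.1 K.2).measurableSet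
      (measure_restrict_ne_top Ω (𝒯.compact K.1 K.2)) (c K)),
      indicatorConstLp_coeFn (μ := volume.restrict Ω) (p := 2)
      (hs := (𝒯.compact K.1 K.2).measurableSet)
      (hμs := measure_restrict_ne_top Ω (𝒯.compact K.1 K.2)) (c := c K)] with x h1 h2 h3
    rw [h1, h2, Pi.smul_apply, h3, Set.indicator_const_smul_apply]

theorem Cells.average_eq_piecewise (𝒯 : Cells) (ε : StrainField Ω) :
    𝒯.average ε = 𝒯.piecewise Ω fun K => ⨍ x in K.1, ε x ∂(volume.restrict Ω) := rfl

theorem Cells.IsPartition.piecewise_ae_eq (h : 𝒯.IsPartition Ω) (c : {K // K ∈ 𝒯.cells} → Voigt)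
    (K : {K // K ∈ 𝒯.cells}) : ∀ᵐ x ∂(volume.restrict Ω), x ∈ K.1 → 𝒯.piecewise Ω c x = c K := by
  have h1 : ∀ᵐ x ∂(volume.restrict Ω), ∀ L : {K // K ∈ 𝒯.cells}, L ≠ K → x ∈ K.1 → x ∉ L.1 := by
    rw [ae_all_iff]
    intro L
    by_cases hL : L = K
    · exact .of_forall fun x h' => absurd hL h'
    have h2 := h.aedisjoint K.1 K.2 L.1 L.2 fun e => hL (Subtype.ext e.symm)
    filter_upwards [measure_eq_zero_iff_ae_notMem.1 h2] with x hx _ hK hL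
    exact hx ⟨hK, hL⟩
  have h2 : ∀ᵐ x ∂(volume.restrict Ω), 𝒯.piecewise Ω c x = ∑ L : {K // K ∈ 𝒯.cells},
      (indicatorConstLp 2 (𝒯.compact L.1 L.2).measurableSet
      (measure_restrict_ne_top Ω (𝒯.compact L.1 L.2)) (c L) : StrainField Ω) x :=
    Lp.coeFn_fun_finsetSum _ _
  have h3 : ∀ᵐ x ∂(volume.restrict Ω), ∀ L : {K // K ∈ 𝒯.cells},
      (indicatorConstLp 2 (𝒯.compact L.1 L.2).measurableSet
      (measure_restrict_ne_top Ω (𝒯.compact L.1 L.2)) (c L) : StrainField Ω) x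
        = L.1.indicator (fun _ => c L) x :=
    ae_all_iff.2 fun L => indicatorConstLp_coeFn
  filter_upwards [h1, h2, h3] with x h1 h2 h3 hx
  rw [h2, Finset.sum_eq_single K]
  · rw [h3, Set.indicator_of_mem hx]
  · intro L _ hL
    rw [h3, Set.indicator_of_notMem (h1 L hL hx)]
  · simp

theorem Cells.IsPartition.ext (h : 𝒯.IsPartition Ω) {ε δ : StrainField Ω}
    (he : ∀ K ∈ 𝒯.cells, ∀ᵐ x ∂(volume.restrict Ω), x ∈ K → ε x = δ x) : ε = δ := by
  apply Lp.ext
  have h1 : ∀ᵐ x ∂(volume.restrict Ω), ∀ K : {K // K ∈ 𝒯.cells}, x ∈ K.1 → ε x = δ x :=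
    ae_all_iff.2 fun K => he K.1 K.2
  filter_upwards [h1, h.cover] with x h1 ⟨K, hK, hx⟩
  exact h1 ⟨K, hK⟩ hx

theorem Cells.IsPartition.exists_piecewise_eq (h : 𝒯.IsPartition Ω) {τ : StrainField Ω}
    (hτ : τ ∈ 𝒯.pwConst Ω) : ∃ c, 𝒯.piecewise Ω c = τ := by
  choose! c hc using hτ
  refine ⟨fun K => c K.1, h.ext fun K hK => ?_⟩
  filter_upwards [hc K hK, h.piecewise_ae_eq (fun K => c K.1) ⟨K, hK⟩] with x h1 h2 hx
  rw [h1 hx, h2 hx]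

theorem Cells.IsPartition.average_ae_eq (h : 𝒯.IsPartition Ω) (ε : StrainField Ω) {K : Set Plane}
    (hK : K ∈ 𝒯.cells) : ∀ᵐ x ∂(volume.restrict Ω), x ∈ K →
      𝒯.average ε x = ⨍ x in K, ε x ∂(volume.restrict Ω) :=
  h.piecewise_ae_eq _ ⟨K, hK⟩

theorem Cells.IsPartition.average_mem (h : 𝒯.IsPartition Ω) (ε : StrainField Ω) :
    𝒯.average ε ∈ 𝒯.pwConst Ω :=
  fun _ hK => ⟨_, h.average_ae_eq ε hK⟩

theorem integrableOn_strainField {K : Set Plane} (hK : IsCompact K) (ε : StrainField Ω) :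
    IntegrableOn ε K (volume.restrict Ω) :=
  integrableOn_Lp_of_measure_ne_top ε (by norm_num) (measure_restrict_ne_top Ω hK)

/-- Tested with an indicator of one cell, the claim is that a field minus its mean has integral zero
over that cell. -/
theorem Cells.IsPartition.pairing_sub_average (h : 𝒯.IsPartition Ω) (ε : StrainField Ω)
    {τ : StrainField Ω} (hτ : τ ∈ 𝒯.pwConst Ω) : pairing τ (ε - 𝒯.average ε) = 0 := by
  obtain ⟨c, rfl⟩ := h.exists_piecewise_eq hτ
  rw [pairing_eq_inner]
  change inner ℝ (∑ K : {K // K ∈ 𝒯.cells}, (indicatorConstLp 2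
    (𝒯.compact K.1 K.2).measurableSet _ (c K) : StrainField Ω)) _ = 0
  rw [sum_inner]
  refine Finset.sum_eq_zero fun K _ => ?_
  rw [L2.inner_indicatorConstLp_eq_inner_setIntegral ℝ]
  have e : ∫ x in K.1, (ε - 𝒯.average ε) x ∂(volume.restrict Ω)
      = ∫ x in K.1, (ε x - ⨍ y in K.1, ε y ∂(volume.restrict Ω)) ∂(volume.restrict Ω) := by
    refine setIntegral_congr_ae (𝒯.compact K.1 K.2).measurableSet ?_
    filter_upwards [Lp.coeFn_sub ε (𝒯.average ε), h.average_ae_eq ε K.2] with x h1 h2 hx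
    rw [h1, Pi.sub_apply, h2 hx]
  rw [e, setAverage_sub_setAverage (measure_restrict_ne_top Ω (𝒯.compact K.1 K.2)), inner_zero_right]

theorem Cells.sub_mem_pwConst {ε δ : StrainField Ω} (hε : ε ∈ 𝒯.pwConst Ω)
    (hδ : δ ∈ 𝒯.pwConst Ω) : ε - δ ∈ 𝒯.pwConst Ω := by
  intro K hK
  obtain ⟨c, hc⟩ := hε K hK
  obtain ⟨d, hd⟩ := hδ K hK
  refine ⟨c - d, ?_⟩
  filter_upwards [hc, hd, Lp.coeFn_sub ε δ] with x h1 h2 h3 hx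
  rw [h3, Pi.sub_apply, h1 hx, h2 hx]

theorem Cells.zero_mem_pwConst : (0 : StrainField Ω) ∈ 𝒯.pwConst Ω := by
  intro K _
  refine ⟨0, ?_⟩
  filter_upwards [Lp.coeFn_zero Voigt 2 (volume.restrict Ω)] with x h1 _
  rw [h1, Pi.zero_apply]

theorem Cells.applyMatrix_mem_pwConst (A : Matrix (Fin 3) (Fin 3) ℝ) {ε : StrainField Ω}
    (hε : ε ∈ 𝒯.pwConst Ω) : applyMatrix A ε ∈ 𝒯.pwConst Ω := by
  intro K hK
  obtain ⟨c, hc⟩ := hε K hK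
  refine ⟨Matrix.toEuclideanCLM (𝕜 := ℝ) A c, ?_⟩
  filter_upwards [hc, coeFn_applyMatrix A ε] with x h1 h2 hx
  rw [h2, h1 hx]

/-- Uniqueness of the orthogonal projection; it identifies the second and third components of
elements of `Z_h`. -/
theorem Cells.IsPartition.eq_average (h : 𝒯.IsPartition Ω) {ε δ : StrainField Ω}
    (hδ : δ ∈ 𝒯.pwConst Ω) (ho : ∀ τ ∈ 𝒯.pwConst Ω, pairing τ (ε - δ) = 0) :
    δ = 𝒯.average ε := by
  have hm := Cells.sub_mem_pwConst hδ (h.average_mem ε)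
  have h1 := ho _ hm
  have h2 := h.pairing_sub_average ε hm
  rw [pairing_eq_inner] at h1 h2
  have h3 : inner ℝ (δ - 𝒯.average ε) (δ - 𝒯.average ε) = (0 : ℝ) := by
    have : δ - 𝒯.average ε = (ε - 𝒯.average ε) - (ε - δ) := by abel
    conv_lhs => rw [this, inner_sub_right]
    rw [← this, h1, h2, sub_zero]
  exact sub_eq_zero.1 (inner_self_eq_zero.1 h3)

/-- `Cells.average` as a linear map. -/
def Cells.averageL (𝒯 : Cells) (Ω : Set Plane) : StrainField Ω →ₗ[ℝ] StrainField Ω where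
  toFun ε := 𝒯.average ε
  map_add' ε δ := by
    rw [average_eq_piecewise, average_eq_piecewise, average_eq_piecewise, ← map_add]
    congr 1
    ext1 K
    have hK := 𝒯.compact K.1 K.2
    rw [Pi.add_apply, setAverage_eq, setAverage_eq, setAverage_eq, ← smul_add,
      ← integral_add (integrableOn_strainField hK _) (integrableOn_strainField hK _)]
    congr 1
    refine setIntegral_congr_ae hK.measurableSet ?_
    filter_upwards [Lp.coeFn_add ε δ] with x h1 _
    rw [h1, Pi.add_apply]
  map_smul' r ε := by
    rw [average_eq_piecewise, average_eq_piecewise, RingHom.id_apply, ← map_smul]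
    congr 1
    ext1 K
    have hK := 𝒯.compact K.1 K.2
    have e : ∫ x in K.1, (r • ε) x ∂(volume.restrict Ω)
        = ∫ x in K.1, r • ε x ∂(volume.restrict Ω) := by
      refine setIntegral_congr_ae hK.measurableSet ?_
      filter_upwards [Lp.coeFn_smul r ε] with x h1 _
      rw [h1, Pi.smul_apply]
    rw [Pi.smul_apply, setAverage_eq, setAverage_eq, e, integral_smul, smul_comm]

/-- Pythagoras: since `D` is constant, `D` times the average is again piecewise constant, so the
average and the remainder are orthogonal in the energy product too. -/
theorem Cells.IsPartition.normY_average_sq_add {D : Matrix (Fin 3) (Fin 3) ℝ} (hD : D.PosDef)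
    (h : 𝒯.IsPartition Ω) (ε : StrainField Ω) :
    normY D (𝒯.average ε) ^ 2 + normY D (ε - 𝒯.average ε) ^ 2 = normY D ε ^ 2 := by
  have h0 := h.pairing_sub_average ε (Cells.applyMatrix_mem_pwConst D (h.average_mem ε))
  obtain ⟨S, hS⟩ := exists_eq_transpose_mul_self hD
  simp only [normY_eq_norm hS]
  rw [hS, pairing_transpose_mul] at h0
  have e : applyMatrix S ε = applyMatrix S (𝒯.average ε) + applyMatrix S (ε - 𝒯.average ε) := by
    rw [applyMatrix_sub]; abel
  rw [e, norm_add_sq_real, h0]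
  ring

theorem Cells.IsPartition.normY_average_le {D : Matrix (Fin 3) (Fin 3) ℝ} (hD : D.PosDef)
    (h : 𝒯.IsPartition Ω) (ε : StrainField Ω) : normY D (𝒯.average ε) ≤ normY D ε := by
  have := h.normY_average_sq_add hD ε
  exact (abs_le_of_sq_le_sq' (by nlinarith [sq_nonneg (normY D (ε - 𝒯.average ε))])
    (normY_nonneg ε)).2

theorem Cells.IsPartition.normY_sub_average_le {D : Matrix (Fin 3) (Fin 3) ℝ} (hD : D.PosDef)
    (h : 𝒯.IsPartition Ω) (ε : StrainField Ω) : normY D (ε - 𝒯.average ε) ≤ normY D ε := by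
  have := h.normY_average_sq_add hD ε
  exact (abs_le_of_sq_le_sq' (by nlinarith [sq_nonneg (normY D (𝒯.average ε))])
    (normY_nonneg ε)).2

end Averaging

/-! ### The discrete problem -/

/-- The `i`-th weak partial derivative as a linear map. -/
def gradL (Ω ΓD : Set Plane) (i : Fin 2) : dispSpace Ω ΓD →ₗ[ℝ] VecField Ω :=
  LinearMap.proj i ∘ₗ LinearMap.snd ℝ (VecField Ω) (Fin 2 → VecField Ω) ∘ₗ
    (dispSpace Ω ΓD).subtype

/-- `strain` as a linear map. -/
def strainL (Ω ΓD : Set Plane) : dispSpace Ω ΓD →ₗ[ℝ] StrainField Ω :=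
  ∑ i, ((strainMap i).compLpL 2 (volume.restrict Ω)).toLinearMap ∘ₗ gradL Ω ΓD i

theorem IsAffineOn.add {p q : Plane → Plane} {K : Set Plane} (hp : IsAffineOn p K)
    (hq : IsAffineOn q K) : IsAffineOn (p + q) K := by
  obtain ⟨A, hA⟩ := hp
  obtain ⟨B, hB⟩ := hq
  exact ⟨A + B, fun x hx => by rw [Pi.add_apply, hA hx, hB hx]; rfl⟩

theorem IsAffineOn.smul {p : Plane → Plane} {K : Set Plane} (r : ℝ) (hp : IsAffineOn p K) :
    IsAffineOn (r • p) K := by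
  obtain ⟨A, hA⟩ := hp
  exact ⟨r • A, fun x hx => by rw [Pi.smul_apply, hA hx]; rfl⟩

section Discrete

variable {n : ℕ} [NeZero n] (M : Mesh n Ω) {D : Matrix (Fin 3) (Fin 3) ℝ}

/-- `Mesh.discSpace` as a subspace. -/
def Mesh.discSubmodule (ΓD : Set Plane) : Submodule ℝ (dispSpace Ω ΓD) where
  carrier := M.discSpace ΓD
  zero_mem' := by
    refine ⟨0, continuousOn_const, ⟨fun _ T _ => ⟨0, fun x _ => rfl⟩,
      fun _ T _ => ⟨fun i => ⟨0, fun x _ => rfl⟩, by simp⟩⟩, ?_⟩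
    filter_upwards [Lp.coeFn_zero Plane 2 (volume.restrict Ω)] with x hx
    exact hx
  add_mem' := by
    rintro v w ⟨p, hp, ⟨hp3, hp4⟩, hvp⟩ ⟨q, hq, ⟨hq3, hq4⟩, hwq⟩
    refine ⟨p + q, hp.add hq, ⟨fun hn T hT => (hp3 hn T hT).add (hq3 hn T hT), fun hn T hT =>
      ⟨fun i => ((hp4 hn T hT).1 i).add ((hq4 hn T hT).1 i), ?_⟩⟩, ?_⟩
    · rw [Pi.add_apply, (hp4 hn T hT).2, (hq4 hn T hT).2, ← smul_add, ← Finset.sum_add_distrib]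
      rfl
    · have e : (v + w).1.1 = v.1.1 + w.1.1 := rfl
      rw [e]
      filter_upwards [hvp, hwq, Lp.coeFn_add v.1.1 w.1.1] with x h1 h2 h3
      rw [Pi.add_apply, ← h1, ← h2, h3, Pi.add_apply]
  smul_mem' := by
    rintro r v ⟨p, hp, ⟨hp3, hp4⟩, hvp⟩
    refine ⟨r • p, hp.const_smul r, ⟨fun hn T hT => (hp3 hn T hT).smul r, fun hn T hT =>
      ⟨fun i => ((hp4 hn T hT).1 i).smul r, ?_⟩⟩, ?_⟩
    · rw [Pi.smul_apply, (hp4 hn T hT).2, smul_comm, Finset.smul_sum]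
      rfl
    · have e : (r • v).1.1 = r • v.1.1 := by rw [Submodule.coe_smul, Prod.smul_fst]
      rw [e]
      filter_upwards [hvp, Lp.coeFn_smul r v.1.1] with x h1 h2
      rw [Pi.smul_apply, ← h1, h2, Pi.smul_apply]

/-- `Mesh.smoothedStrain` as a linear map. -/
def Mesh.smoothedStrainL (ΓD : Set Plane) : dispSpace Ω ΓD →ₗ[ℝ] StrainField Ω :=
  M.vertexMesh.averageL Ω ∘ₗ M.edgeMesh.averageL Ω ∘ₗ strainL Ω ΓD

/-- The three choices are independent, so a bound for every triple passes to the infima one variable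
at a time. -/
theorem le_two_mul_iInf_add {ι₁ ι₂ ι₃ : Type*} [Nonempty ι₁] [Nonempty ι₂] [Nonempty ι₃]
    {a : ι₁ → ℝ} {b : ι₂ → ℝ} {c : ι₃ → ℝ} {x C : ℝ} (hC : 0 ≤ C)
    (h : ∀ i j k, x ≤ 2 * a i + C * (b j + c k)) :
    x ≤ 2 * (⨅ i, a i) + C * ((⨅ j, b j) + ⨅ k, c k) := by
  rw [mul_add, Real.mul_iInf_of_nonneg zero_le_two, Real.mul_iInf_of_nonneg hC,
    Real.mul_iInf_of_nonneg hC]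
  have h3 : x - (⨅ i, 2 * a i) - (⨅ j, C * b j) ≤ ⨅ k, C * c k := by
    refine le_ciInf fun k => ?_
    have h2 : x - (⨅ i, 2 * a i) - C * c k ≤ ⨅ j, C * b j := by
      refine le_ciInf fun j => ?_
      have h1 : x - C * b j - C * c k ≤ ⨅ i, 2 * a i :=
        le_ciInf fun i => by linarith [h i j k]
      linarith
    linarith
  linarith

/-- Cauchy-Schwarz, applied to the difference and to its negative. -/
theorem pairing_applyMatrix_congr (hD : D.PosDef) {ε δ δ' : StrainField Ω}
    (h : normY D (δ - δ') = 0) :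
    pairing (applyMatrix D ε) δ = pairing (applyMatrix D ε) δ' := by
  have h1 := pairing_applyMatrix_le hD ε (δ - δ')
  have h2 := pairing_applyMatrix_le hD ε (δ' - δ)
  rw [normY_sub_comm hD, h, mul_zero] at h2
  rw [h, mul_zero] at h1
  rw [pairing_eq_inner, inner_sub_right] at h1 h2
  rw [pairing_eq_inner, pairing_eq_inner]
  linarith

/-- The remainder of averaging is orthogonal to `τ`, so `σ` may be replaced by `σ - τ`;
Cauchy-Schwarz and the contractivity of the complementary projection finish. -/
theorem pairing_sub_average_le (hD : D.PosDef) {𝒯 : Cells} (h : 𝒯.IsPartition Ω)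
    {τ : StrainField Ω} (hτ : τ ∈ 𝒯.pwConst Ω) (σ ε : StrainField Ω) :
    pairing σ (ε - 𝒯.average ε) ≤ normYDual D (σ - τ) * normY D ε := by
  have h1 := h.pairing_sub_average ε hτ
  have h2 := pairing_le_normYDual_mul hD (σ - τ) (ε - 𝒯.average ε)
  rw [pairing_eq_inner, inner_sub_left] at h2
  rw [pairing_eq_inner] at h1 ⊢
  rw [h1, sub_zero] at h2
  exact h2.trans (mul_le_mul_of_nonneg_left (h.normY_sub_average_le hD ε) (normYDual_nonneg _))

/-- The abstract core of the error estimate, a Strang-type argument. Here `δ` and `δ'` are discrete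
smoothed strains and `η` is the strain of a test function; `heq` expresses that both weak problems
have the same right-hand side on it. -/
theorem normY_sub_le_of_lift (hD : D.PosDef) {𝒯₁ 𝒯₂ : Cells} (h1 : 𝒯₁.IsPartition Ω)
    (h2 : 𝒯₂.IsPartition Ω) {C : ℝ} (hC : 0 ≤ C) {ε δ δ' η τ₁ τ₂ : StrainField Ω}
    (hτ₁ : τ₁ ∈ 𝒯₁.pwConst Ω) (hτ₂ : τ₂ ∈ 𝒯₂.pwConst Ω)
    (h0 : normY D (𝒯₂.average (𝒯₁.average η) - (δ - δ')) = 0)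
    (hle : normY D η ≤ C * normY D (δ - δ'))
    (heq : pairing (applyMatrix D δ) (𝒯₂.average (𝒯₁.average η))
      = pairing (applyMatrix D ε) η) :
    normY D (ε - δ) ≤ 2 * normY D (ε - δ') +
      C * (normYDual D (applyMatrix D ε - τ₁) + normYDual D (applyMatrix D ε - τ₂)) := by
  have hE0 : 0 ≤ normY D (δ - δ') := normY_nonneg _
  have ha0 : 0 ≤ normY D (ε - δ') := normY_nonneg _
  -- In every second slot `δ - δ'` can be exchanged for `P₂P₁η`. The two consistency terms telescope
  -- to `(Dε, η - P₂P₁η)`, and `heq` converts `(Dε, η)` to `(Dδ, P₂P₁η)`.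
  have key : normY D (δ - δ') ^ 2 = pairing (applyMatrix D ε) (η - 𝒯₁.average η)
      + pairing (applyMatrix D ε) (𝒯₁.average η - 𝒯₂.average (𝒯₁.average η))
      + pairing (applyMatrix D (ε - δ')) (δ - δ') := by
    rw [normY_sq hD, ← pairing_applyMatrix_congr hD h0, ← pairing_applyMatrix_congr hD h0]
    rw [applyMatrix_sub, applyMatrix_sub]
    simp only [pairing_eq_inner, inner_sub_left, inner_sub_right] at heq ⊢
    linarith
  have b1 := pairing_sub_average_le hD h1 hτ₁ (applyMatrix D ε) η
  have b2 := pairing_sub_average_le hD h2 hτ₂ (applyMatrix D ε) (𝒯₁.average η)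
  have b3 := pairing_applyMatrix_le hD (ε - δ') (δ - δ')
  have n1 := normYDual_nonneg (D := D) (applyMatrix D ε - τ₁)
  have n2 := normYDual_nonneg (D := D) (applyMatrix D ε - τ₂)
  have c1 := mul_le_mul_of_nonneg_left hle n1
  have c2 := mul_le_mul_of_nonneg_left ((h1.normY_average_le hD η).trans hle) n2
  have tri := normY_add_le hD (ε - δ') (δ' - δ)
  rw [sub_add_sub_cancel, normY_sub_comm hD δ'] at tri
  generalize normYDual D (applyMatrix D ε - τ₁) = s₁ at *
  generalize normYDual D (applyMatrix D ε - τ₂) = s₂ at *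
  generalize normY D (δ - δ') = E at *
  generalize normY D (ε - δ') = a at *
  have hE2 : E * E ≤ (a + C * (s₁ + s₂)) * E := by nlinarith
  -- Cancel one factor `E`. The factor 2 of the estimate then comes from the triangle inequality,
  -- which adds `a` once more.
  have hEle : E ≤ a + C * (s₁ + s₂) := by
    rcases hE0.eq_or_lt with h0 | h0
    · rw [← h0]; positivity
    · exact le_of_mul_le_mul_right hE2 h0
  linarith

theorem errorEstimate_of_lift (hD : D.PosDef) (h1 : M.edgeMesh.IsPartition Ω)
    (h2 : M.vertexMesh.IsPartition Ω) {C : ℝ} (hC : 0 ≤ C)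
    (hlift : ∀ w ∈ M.discSpace ΓD, ∃ w' ∈ M.discSpace ΓD,
      normY D (M.smoothedStrain w' - M.smoothedStrain w) = 0 ∧
      normY D (strain w') ≤ C * normY D (M.smoothedStrain w))
    {f : dispSpace Ω ΓD →L[ℝ] ℝ} {u uh : dispSpace Ω ΓD} (hu : SolvesWeak D f u)
    (huh : SolvesSSE D M f uh) : ErrorEstimate D M u uh C := by
  have : Nonempty (M.discSpace ΓD) := ⟨⟨uh, huh.1⟩⟩
  have : Nonempty M.W1 := ⟨⟨0, Cells.zero_mem_pwConst⟩⟩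
  have : Nonempty M.W2 := ⟨⟨0, Cells.zero_mem_pwConst⟩⟩
  refine le_two_mul_iInf_add hC ?_
  rintro ⟨v, hv⟩ ⟨τ₁, hτ₁⟩ ⟨τ₂, hτ₂⟩
  dsimp only
  obtain ⟨w, hwV, hw0, hwC⟩ := hlift _ ((M.discSubmodule ΓD).sub_mem huh.1 hv)
  have hsub : M.smoothedStrain (uh - v) = M.smoothedStrain uh - M.smoothedStrain v :=
    (M.smoothedStrainL ΓD).map_sub uh v
  rw [hsub] at hw0 hwC
  exact normY_sub_le_of_lift hD h1 h2 hC hτ₁ hτ₂ hw0 hwC ((huh.2 w hwV).trans (hu w).symm)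

theorem ErrorEstimate.mono {M : Mesh n Ω} {u uh : dispSpace Ω ΓD} {C C' : ℝ} (h : C ≤ C')
    (he : ErrorEstimate D M u uh C) : ErrorEstimate D M u uh C' := by
  refine le_trans he (add_le_add le_rfl (mul_le_mul_of_nonneg_right h (add_nonneg ?_ ?_)))
  · exact Real.iInf_nonneg fun _ => normYDual_nonneg _
  · exact Real.iInf_nonneg fun _ => normYDual_nonneg _

theorem normY_strain_le_normPi (U : dispSpace Ω ΓD × StrainField Ω × StrainField Ω) :
    normY D (strain U.1) ≤ normPi D U :=
  Real.le_sqrt_of_sq_le (by nlinarith [sq_nonneg (normY D U.2.1), sq_nonneg (normY D U.2.2)])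

theorem mem_discKernelZ (h1 : M.edgeMesh.IsPartition Ω) (h2 : M.vertexMesh.IsPartition Ω)
    {w : dispSpace Ω ΓD} (hw : w ∈ M.discSpace ΓD) :
    (w, M.edgeMesh.average (strain w), M.smoothedStrain w) ∈ discKernelZ M ΓD := by
  refine ⟨⟨hw, h1.average_mem _, h2.average_mem _⟩, fun Q hQ1 hQ2 => ?_⟩
  have e1 := h1.pairing_sub_average (strain w) hQ1
  have e2 := h2.pairing_sub_average (M.edgeMesh.average (strain w)) hQ2
  exact (congrArg₂ (· + ·) e1 e2).trans (add_zero 0)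

theorem errorEstimate_of_stability (hD : D.PosDef) (h1 : M.edgeMesh.IsPartition Ω)
    (h2 : M.vertexMesh.IsPartition Ω) {α : ℝ} (hα : 0 < α) (hs : StabilityAssumption D M ΓD α)
    {f : dispSpace Ω ΓD →L[ℝ] ℝ} {u uh : dispSpace Ω ΓD} (hu : SolvesWeak D f u)
    (huh : SolvesSSE D M f uh) : ErrorEstimate D M u uh (2 / α) := by
  -- The argument yields the smaller constant `1 / α`; the test function is the discrete difference
  -- itself.
  refine ErrorEstimate.mono (C := 1 / α) (by gcongr; norm_num) ?_
  refine errorEstimate_of_lift M hD h1 h2 (by positivity) (fun w hw => ⟨w, hw, ?_, ?_⟩) hu huh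
  · rw [sub_self, normY_zero]
  · have h := hs _ (Or.inr (mem_discKernelZ M h1 h2 hw))
    rw [seminormPi] at h
    rw [div_mul_eq_mul_div, one_mul, le_div_iff₀ hα, mul_comm]
    exact (mul_le_mul_of_nonneg_left (normY_strain_le_normPi
      (w, M.edgeMesh.average (strain w), M.smoothedStrain w)) hα.le).trans h

/-- On the finite-dimensional range of `F` restricted to `W` there is a linear section, and its
composition with `G` is automatically bounded. Neither injectivity of `F` nor finite dimension of
`W` is needed. -/
theorem exists_lift_of_linearMap {V H : Type*} [AddCommGroup V] [Module ℝ V]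
    [NormedAddCommGroup H] [NormedSpace ℝ H] (W : Submodule ℝ V) (F G : V →ₗ[ℝ] H)
    [FiniteDimensional ℝ (LinearMap.range F)] :
    ∃ C, 0 < C ∧ ∀ w ∈ W, ∃ w' ∈ W, F w' = F w ∧ ‖G w'‖ ≤ C * ‖F w‖ := by
  let F' : W →ₗ[ℝ] H := F ∘ₗ W.subtype
  have : FiniteDimensional ℝ (LinearMap.range F') := by
    refine Submodule.finiteDimensional_of_le (S₂ := LinearMap.range F) ?_
    rintro _ ⟨w, rfl⟩
    exact ⟨w, rfl⟩
  obtain ⟨s, hs⟩ := F'.rangeRestrict.exists_rightInverse_of_surjective F'.range_rangeRestrict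
  let L := LinearMap.toContinuousLinearMap (G ∘ₗ W.subtype ∘ₗ s)
  -- The summand 1 only serves to make the constant positive.
  refine ⟨‖L‖ + 1, by positivity, fun w hw => ?_⟩
  let e := F'.rangeRestrict ⟨w, hw⟩
  refine ⟨(s e).1, (s e).2, congrArg Subtype.val (LinearMap.congr_fun hs e), ?_⟩
  refine (L.le_opNorm e).trans ?_
  change ‖L‖ * ‖F w‖ ≤ _
  gcongr
  linarith

/-- Smoothed strains are determined by finitely many cell values, so the section argument applies on
every mesh; composing with `S` makes it speak about energy norms. -/
theorem exists_lift (hD : D.PosDef) (ΓD : Set Plane) : ∃ C, 0 < C ∧ ∀ w ∈ M.discSpace ΓD,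
    ∃ w' ∈ M.discSpace ΓD, normY D (M.smoothedStrain w' - M.smoothedStrain w) = 0 ∧
      normY D (strain w') ≤ C * normY D (M.smoothedStrain w) := by
  obtain ⟨S, hS⟩ := exists_eq_transpose_mul_self hD
  have : FiniteDimensional ℝ
      (LinearMap.range ((applyMatrixL Ω S).toLinearMap ∘ₗ M.smoothedStrainL ΓD)) := by
    refine Submodule.finiteDimensional_of_le (S₂ := (LinearMap.range
      (M.vertexMesh.piecewise Ω)).map (applyMatrixL Ω S).toLinearMap) ?_
    rintro _ ⟨w, rfl⟩
    exact ⟨M.smoothedStrain w, ⟨_, rfl⟩, rfl⟩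
  obtain ⟨C, hC, h⟩ := exists_lift_of_linearMap (M.discSubmodule ΓD)
    ((applyMatrixL Ω S).toLinearMap ∘ₗ M.smoothedStrainL ΓD)
    ((applyMatrixL Ω S).toLinearMap ∘ₗ strainL Ω ΓD)
  refine ⟨C, hC, fun w hw => ?_⟩
  obtain ⟨w', hw', h1, h2⟩ := h w hw
  have h1' : applyMatrix S (M.smoothedStrain w') = applyMatrix S (M.smoothedStrain w) := h1
  refine ⟨w', hw', ?_, ?_⟩
  · rw [normY_eq_norm hS, applyMatrix_sub, h1', sub_self, norm_zero]
  · rw [normY_eq_norm hS, normY_eq_norm hS]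
    exact h2

end Discrete

/-! ### Plane geometry -/

theorem cross_smul_add_smul (w c x y : Plane) {a b : ℝ} (h : a + b = 1) :
    cross w (a • x + b • y - c) = a * cross w (x - c) + b * cross w (y - c) := by
  obtain rfl : b = 1 - a := by linarith
  simp only [cross, PiLp.sub_apply, PiLp.add_apply, PiLp.smul_apply, smul_eq_mul]
  ring

theorem cross_neg_left (w x : Plane) : cross (-w) x = -cross w x := by
  simp only [cross, PiLp.neg_apply]
  ring

theorem cross_self (w : Plane) : cross w w = 0 := by
  simp only [cross]
  ring

theorem cross_swap (v w : Plane) : cross v w = -cross w v := by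
  simp only [cross]
  ring

theorem cross_zero_right (w : Plane) : cross w 0 = 0 := by simp [cross]

theorem cross_zero_left (w : Plane) : cross 0 w = 0 := by simp [cross]

theorem ne_zero_of_cross_pos {v w : Plane} (h : 0 < cross v w) : v ≠ 0 := by
  rintro rfl
  rw [cross_zero_left] at h
  exact h.false

/-- The cross product as a bilinear map. -/
def crossL : Plane →ₗ[ℝ] Plane →ₗ[ℝ] ℝ :=
  LinearMap.mk₂ ℝ cross
    (fun x y z => by simp only [cross, PiLp.add_apply]; ring)
    (fun r x y => by simp only [cross, PiLp.smul_apply, smul_eq_mul]; ring)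
    (fun x y z => by simp only [cross, PiLp.add_apply]; ring)
    (fun r x y => by simp only [cross, PiLp.smul_apply, smul_eq_mul]; ring)

theorem crossL_apply (v w : Plane) : crossL v w = cross v w := rfl

theorem continuous_cross (w c : Plane) : Continuous fun x => cross w (x - c) :=
  (crossL w).continuous_of_finiteDimensional.comp (continuous_id.sub continuous_const)

theorem cross_nonneg_of_mem_convexHull {s : Set Plane} {w c x : Plane}
    (h : ∀ y ∈ s, 0 ≤ cross w (y - c)) (hx : x ∈ convexHull ℝ s) : 0 ≤ cross w (x - c) := by
  have hc : Convex ℝ {x | 0 ≤ cross w (x - c)} := by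
    intro x hx y hy a b ha hb hab
    rw [mem_ofPred_eq, cross_smul_add_smul w c x y hab]
    exact add_nonneg (mul_nonneg ha hx) (mul_nonneg hb hy)
  exact convexHull_min (t := {x | 0 ≤ cross w (x - c)}) h hc hx

theorem cross_nonpos_of_mem_convexHull {s : Set Plane} {w c x : Plane}
    (h : ∀ y ∈ s, cross w (y - c) ≤ 0) (hx : x ∈ convexHull ℝ s) : cross w (x - c) ≤ 0 := by
  have := cross_nonneg_of_mem_convexHull (w := -w) (c := c)
    (fun y hy => by rw [cross_neg_left]; linarith [h y hy]) hx
  rw [cross_neg_left] at this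
  linarith

theorem volume_line {w : Plane} (hw : w ≠ 0) (c : Plane) :
    volume {x : Plane | cross w (x - c) = 0} = 0 := by
  have e : {x : Plane | cross w (x - c) = 0} = AffineSubspace.mk' c (LinearMap.ker (crossL w)) := by
    ext x
    simp [crossL_apply]
  rw [e]
  refine Measure.addHaar_affineSubspace _ _ fun h => hw ?_
  have h1 : ∀ v, cross w v = 0 := fun v => by
    have : c + v ∈ AffineSubspace.mk' c (LinearMap.ker (crossL w)) := by rw [h]; trivial
    simpa [crossL_apply] using this
  -- The cross product of `w` with its rotation by a right angle is the squared length of `w`.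
  have h2 := h1 !₂[- w 1, w 0]
  simp only [cross, Matrix.cons_val_zero, Matrix.cons_val_one] at h2
  have h3 : w 0 = 0 := by nlinarith [sq_nonneg (w 0), sq_nonneg (w 1)]
  have h4 : w 1 = 0 := by nlinarith [sq_nonneg (w 0), sq_nonneg (w 1)]
  ext i
  fin_cases i
  · exact h3
  · exact h4

theorem aedisjoint_convexHull {s t : Set Plane} {w : Plane} (hw : w ≠ 0) (c : Plane)
    (hs : ∀ y ∈ s, 0 ≤ cross w (y - c)) (ht : ∀ y ∈ t, cross w (y - c) ≤ 0) :
    AEDisjoint volume (convexHull ℝ s) (convexHull ℝ t) :=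
  measure_mono_null (fun _ hx => le_antisymm (cross_nonpos_of_mem_convexHull ht hx.2)
    (cross_nonneg_of_mem_convexHull hs hx.1)) (volume_line hw c)

theorem volume_segment {p q : Plane} (h : p ≠ q) : volume (segment ℝ p q) = 0 := by
  refine measure_mono_null (fun x hx => ?_) (volume_line (sub_ne_zero.2 h.symm) p)
  rw [← convexHull_pair] at hx
  have h0 : ∀ y ∈ ({p, q} : Set Plane), cross (q - p) (y - p) = 0 := by
    rintro y (rfl | rfl)
    · rw [sub_self, cross_zero_right]
    · exact cross_self _
  exact le_antisymm (cross_nonpos_of_mem_convexHull (fun y hy => (h0 y hy).le) hx)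
    (cross_nonneg_of_mem_convexHull (fun y hy => (h0 y hy).ge) hx)

theorem smul_add_smul_add_smul_mem_convexHull {a b c : Plane} {r s t : ℝ} (hr : 0 ≤ r)
    (hs : 0 ≤ s) (ht : 0 ≤ t) (h : r + s + t = 1) :
    r • a + s • b + t • c ∈ convexHull ℝ {a, b, c} := by
  have := (convex_convexHull ℝ ({a, b, c} : Set Plane)).sum_mem (t := Finset.univ)
    (w := ![r, s, t]) (z := ![a, b, c]) ?_ ?_ ?_
  · simpa [Fin.sum_univ_three] using this
  · intro i _; fin_cases i <;> assumption
  · simpa [Fin.sum_univ_three] using h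
  · intro i _
    apply subset_convexHull
    fin_cases i <;> simp

/-- The three cross products divided by the one of the whole triangle are the barycentric
coordinates of `x`. -/
theorem mem_triangle_of_cross {a b c x : Plane} (hJ : 0 < cross (b - a) (c - a))
    (h1 : 0 ≤ cross (b - a) (x - a)) (h2 : 0 ≤ cross (c - b) (x - b))
    (h3 : 0 ≤ cross (a - c) (x - c)) : x ∈ convexHull ℝ {a, b, c} := by
  have e : x = (cross (c - b) (x - b) / cross (b - a) (c - a)) • a
      + (cross (a - c) (x - c) / cross (b - a) (c - a)) • b
      + (cross (b - a) (x - a) / cross (b - a) (c - a)) • c := by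
    ext i
    have hJ' := hJ.ne'
    simp only [PiLp.add_apply, PiLp.smul_apply, smul_eq_mul]
    field_simp
    fin_cases i <;> simp only [cross, PiLp.sub_apply, Fin.zero_eta, Fin.mk_one, Fin.isValue] <;> ring
  rw [e]
  refine smul_add_smul_add_smul_mem_convexHull (by positivity) (by positivity) (by positivity) ?_
  field_simp
  simp only [cross, PiLp.sub_apply]
  ring

/-- The reference triangle. -/
def unitTriangle : Set Plane := convexHull ℝ {0, unitVec 0, unitVec 1}

/-- The triangle is an affine image of the reference triangle. The area of the latter can stay
unevaluated: only that it is finite and nonzero matters. -/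
theorem volume_triangle (a b c : Plane) : volume (convexHull ℝ {a, b, c})
    = ENNReal.ofReal |cross (b - a) (c - a)| * volume unitTriangle := by
  let A : Matrix (Fin 2) (Fin 2) ℝ := !![(b - a) 0, (c - a) 0; (b - a) 1, (c - a) 1]
  let L : Plane →ₗ[ℝ] Plane := Matrix.toLpLin 2 2 A
  have hL0 : L (unitVec 0) = b - a := by
    ext i
    fin_cases i <;> simp [L, A, unitVec, Matrix.toLpLin_apply]
  have hL1 : L (unitVec 1) = c - a := by
    ext i
    fin_cases i <;> simp [L, A, unitVec, Matrix.toLpLin_apply]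
  have hdet : LinearMap.det L = cross (b - a) (c - a) := by
    simp only [L, LinearMap.det_toLpLin, A, Matrix.det_fin_two_of, cross]
    ring
  let f : Plane →ᵃ[ℝ] Plane := AffineMap.const ℝ Plane a + L.toAffineMap
  have hf : ∀ x, f x = a + L x := fun _ => rfl
  have himg : convexHull ℝ {a, b, c} = (fun x => a + x) '' (L '' unitTriangle) := by
    rw [image_image, unitTriangle]
    have := f.image_convexHull {0, unitVec 0, unitVec 1}
    rw [image_insert_eq, image_pair, hf, hf, hf, hL0, hL1, map_zero] at this
    simp only [add_zero, add_sub_cancel] at this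
    rw [← this]
    rfl
  rw [himg, image_add_left, measure_preimage_add, Measure.addHaar_image_linearMap, hdet]

theorem isCompact_triangle (a b c : Plane) : IsCompact (convexHull ℝ {a, b, c}) :=
  (Set.toFinite _).isCompact_convexHull ℝ

theorem volume_unitTriangle_ne_top : volume unitTriangle ≠ ⊤ :=
  (isCompact_triangle _ _ _).measure_lt_top.ne

theorem isOpen_cross_pos (w c : Plane) : IsOpen {x | 0 < cross w (x - c)} :=
  isOpen_lt continuous_const (continuous_cross w c)

theorem volume_unitTriangle_ne_zero : volume unitTriangle ≠ 0 := by
  have hJ : 0 < cross (unitVec 0 - 0) (unitVec 1 - 0) := by simp [cross, unitVec]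
  refine fun h => (((isOpen_cross_pos (unitVec 0 - 0) 0).inter
    (isOpen_cross_pos (unitVec 1 - unitVec 0) (unitVec 0))).inter
    (isOpen_cross_pos (0 - unitVec 1) (unitVec 1))).measure_ne_zero volume ?_
    (measure_mono_null (fun x hx => ?_) h)
  · refine ⟨!₂[1 / 4, 1 / 4], ⟨?_, ?_⟩, ?_⟩ <;> norm_num [cross, unitVec]
  · exact mem_triangle_of_cross hJ hx.1.1.le hx.1.2.le hx.2.le

/-- Two triangles on the same side of a common edge overlap: the midpoint of the edge, pushed
slightly inwards, is interior to both. -/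
theorem volume_triangle_inter_ne_zero {p q c c' : Plane} (h : 0 < cross (q - p) (c - p))
    (h' : 0 < cross (q - p) (c' - p)) :
    volume (convexHull ℝ {p, q, c} ∩ convexHull ℝ {p, q, c'}) ≠ 0 := by
  have hO : IsOpen (({x | 0 < cross (c - q) (x - q)} ∩ {x | 0 < cross (p - c) (x - c)}) ∩
      ({x | 0 < cross (c' - q) (x - q)} ∩ {x | 0 < cross (p - c') (x - c')})) :=
    ((isOpen_cross_pos _ _).inter (isOpen_cross_pos _ _)).inter
      ((isOpen_cross_pos _ _).inter (isOpen_cross_pos _ _))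
  have key : ∀ c, 0 < cross (q - p) (c - p) →
      0 < cross (c - q) (midpoint ℝ p q - q) ∧ 0 < cross (p - c) (midpoint ℝ p q - c) := by
    intro c h
    simp only [midpoint_eq_smul_add, cross, PiLp.sub_apply, PiLp.smul_apply, PiLp.add_apply,
      smul_eq_mul, invOf_eq_inv] at h ⊢
    constructor <;> linarith
  obtain ⟨t, ht, ht0⟩ : ∃ t : ℝ, (midpoint ℝ p q + t • (c - p)) ∈
      (({x | 0 < cross (c - q) (x - q)} ∩ {x | 0 < cross (p - c) (x - c)}) ∩
      ({x | 0 < cross (c' - q) (x - q)} ∩ {x | 0 < cross (p - c') (x - c')})) ∧ 0 < t := by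
    have hcont : Filter.Tendsto (fun t : ℝ => midpoint ℝ p q + t • (c - p))
        (nhdsWithin 0 (Ioi 0)) (nhds (midpoint ℝ p q)) := by
      have : Continuous fun t : ℝ => midpoint ℝ p q + t • (c - p) := by fun_prop
      have h0 := this.tendsto 0
      rw [zero_smul, add_zero] at h0
      exact h0.mono_left nhdsWithin_le_nhds
    have h1 := hcont.eventually (hO.mem_nhds ⟨⟨(key c h).1, (key c h).2⟩, (key c' h').1,
      (key c' h').2⟩)
    exact (h1.and self_mem_nhdsWithin).exists
  have hz : 0 < cross (q - p) (midpoint ℝ p q + t • (c - p) - p) := by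
    have e : cross (q - p) (midpoint ℝ p q + t • (c - p) - p) = t * cross (q - p) (c - p) := by
      simp only [midpoint_eq_smul_add, cross, PiLp.sub_apply, PiLp.smul_apply, PiLp.add_apply,
        smul_eq_mul, invOf_eq_inv]
      ring
    rw [e]
    positivity
  refine fun h0 => ((isOpen_cross_pos (q - p) p).inter hO).measure_ne_zero volume ⟨_, hz, ht⟩
    (measure_mono_null ?_ h0)
  exact fun x hx => ⟨mem_triangle_of_cross h hx.1.le hx.2.1.1.le hx.2.1.2.le,
    mem_triangle_of_cross h' hx.1.le hx.2.2.1.le hx.2.2.2.le⟩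

theorem triangle_eq_union {c a b : Plane} (hJ : 0 < cross (a - c) (b - c)) :
    convexHull ℝ {c, a, b} =
      convexHull ℝ {c, a, midpoint ℝ a b} ∪ convexHull ℝ {c, midpoint ℝ a b, b} := by
  have hm : midpoint ℝ a b ∈ convexHull ℝ ({c, a, b} : Set Plane) :=
    segment_subset_convexHull (by simp) (by simp) (midpoint_mem_segment a b)
  have hc : c ∈ convexHull ℝ ({c, a, b} : Set Plane) := subset_convexHull _ _ (by simp)
  have ha : a ∈ convexHull ℝ ({c, a, b} : Set Plane) := subset_convexHull _ _ (by simp)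
  have hb : b ∈ convexHull ℝ ({c, a, b} : Set Plane) := subset_convexHull _ _ (by simp)
  apply Subset.antisymm
  · intro x hx
    have hJ' := hJ
    have h1 : 0 ≤ cross (a - c) (x - c) := cross_nonneg_of_mem_convexHull (by
      rintro y (rfl | rfl | rfl)
      · simp [cross]
      · exact (cross_self _).ge
      · exact hJ.le) hx
    have h2 : 0 ≤ cross (b - a) (x - a) := cross_nonneg_of_mem_convexHull (by
      rintro y (rfl | rfl | rfl)
      · simp only [cross, PiLp.sub_apply] at hJ ⊢; linarith
      · simp [cross]
      · exact (cross_self _).ge) hx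
    have h3 : 0 ≤ cross (c - b) (x - b) := cross_nonneg_of_mem_convexHull (by
      rintro y (rfl | rfl | rfl)
      · exact (cross_self _).ge
      · simp only [cross, PiLp.sub_apply] at hJ ⊢; linarith
      · simp [cross]) hx
    rcases le_total (cross (midpoint ℝ a b - c) (x - c)) 0 with h | h
    · left
      simp only [midpoint_eq_smul_add, cross, PiLp.sub_apply, PiLp.smul_apply, PiLp.add_apply,
        smul_eq_mul, invOf_eq_inv] at h h1 h2 h3 hJ
      apply mem_triangle_of_cross <;>
      · simp only [midpoint_eq_smul_add, cross, PiLp.sub_apply, PiLp.smul_apply, PiLp.add_apply,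
          smul_eq_mul, invOf_eq_inv]
        linarith
    · right
      simp only [midpoint_eq_smul_add, cross, PiLp.sub_apply, PiLp.smul_apply, PiLp.add_apply,
        smul_eq_mul, invOf_eq_inv] at h h1 h2 h3 hJ
      apply mem_triangle_of_cross <;>
      · simp only [midpoint_eq_smul_add, cross, PiLp.sub_apply, PiLp.smul_apply, PiLp.add_apply,
          smul_eq_mul, invOf_eq_inv]
        linarith
  · refine union_subset (convexHull_min ?_ (convex_convexHull ℝ _))
      (convexHull_min ?_ (convex_convexHull ℝ _))
    · rintro y (rfl | rfl | rfl) <;> assumption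
    · rintro y (rfl | rfl | rfl) <;> assumption

theorem aedisjoint_half_triangles {c a b : Plane} (hJ : 0 < cross (a - c) (b - c)) :
    AEDisjoint volume (convexHull ℝ {c, midpoint ℝ a b, b})
      (convexHull ℝ {c, a, midpoint ℝ a b}) := by
  have h1 : 0 < cross (midpoint ℝ a b - c) (b - c) := by
    simp only [midpoint_eq_smul_add, cross, PiLp.sub_apply, PiLp.smul_apply, PiLp.add_apply,
      smul_eq_mul, invOf_eq_inv] at hJ ⊢
    linarith
  have h2 : cross (midpoint ℝ a b - c) (a - c) < 0 := by
    simp only [midpoint_eq_smul_add, cross, PiLp.sub_apply, PiLp.smul_apply, PiLp.add_apply,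
      smul_eq_mul, invOf_eq_inv] at hJ ⊢
    linarith
  refine aedisjoint_convexHull (ne_zero_of_cross_pos h1) c ?_ ?_
  · rintro y (rfl | rfl | rfl)
    · simp [cross]
    · exact (cross_self _).ge
    · exact h1.le
  · rintro y (rfl | rfl | rfl)
    · simp [cross]
    · exact h2.le
    · exact (cross_self _).le

/-! ### The cells of a mesh -/

theorem vertex_mem_cell {n : ℕ} (T : Fin n → Plane) (i : Fin n) : T i ∈ cell T :=
  subset_convexHull ℝ _ (mem_range_self i)

section Polygon

variable {n : ℕ} [inst : NeZero n]

theorem fin_add_one_ne (hn : n = 3 ∨ n = 4) (i : Fin n) :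
    i + 1 ≠ i ∧ i + 1 + 1 ≠ i ∧ i + 1 + 1 ≠ i + 1 := by
  rcases hn with rfl | rfl <;>
  · obtain rfl : inst = ⟨by norm_num⟩ := Subsingleton.elim _ _
    revert i
    decide

theorem fin_cases_of_ne (hn : n = 3 ∨ n = 4) {i j : Fin n} (h : i ≠ j) :
    j = i + 1 ∨ i = j + 1 ∨ n = 4 ∧ j = i + 1 + 1 := by
  rcases hn with rfl | rfl <;>
  · obtain rfl : inst = ⟨by norm_num⟩ := Subsingleton.elim _ _
    revert i j
    decide

variable {T : Fin n → Plane}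

theorem cross_edge_nonneg (hT : IsConvexCCW T) (i j : Fin n) :
    0 ≤ cross (T (i + 1) - T i) (T j - T i) := by
  by_cases h1 : j = i
  · rw [h1, sub_self, cross_zero_right]
  by_cases h2 : j = i + 1
  · rw [h2, cross_self]
  · exact (hT i j h1 h2).le

theorem sum_sub_center (T : Fin n → Plane) : ∑ j, (T j - center T) = 0 := by
  have hn : (n : ℝ) ≠ 0 := Nat.cast_ne_zero.2 (NeZero.ne n)
  rw [Finset.sum_sub_distrib, Finset.sum_const, Finset.card_univ, Fintype.card_fin, center,
    ← Nat.cast_smul_eq_nsmul ℝ, smul_smul, mul_inv_cancel₀ hn, one_smul, sub_self]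

theorem cross_sub_center_eq (c p q : Plane) : cross (p - c) (q - c) = cross (q - p) (c - p) := by
  simp only [cross, PiLp.sub_apply]
  ring

/-- The signed distance of the center from an edge line is the mean of those of the vertices, all
nonnegative and at least one positive. -/
theorem cross_center_pos (hn : n = 3 ∨ n = 4) (hT : IsConvexCCW T) (i : Fin n) :
    0 < cross (T i - center T) (T (i + 1) - center T) := by
  have hn0 : (0 : ℝ) < n := Nat.cast_pos.2 (NeZero.pos n)
  have e : (n : ℝ) * cross (T (i + 1) - T i) (center T - T i)
      = ∑ j, cross (T (i + 1) - T i) (T j - T i) := by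
    simp only [← crossL_apply]
    rw [← map_sum, ← smul_eq_mul, ← map_smul]
    congr 1
    rw [Finset.sum_sub_distrib, Finset.sum_const, Finset.card_univ, Fintype.card_fin, center,
      ← Nat.cast_smul_eq_nsmul ℝ, smul_sub, smul_smul, mul_inv_cancel₀ hn0.ne', one_smul]
  have h := fin_add_one_ne hn i
  have hpos : 0 < ∑ j, cross (T (i + 1) - T i) (T j - T i) :=
    Finset.sum_pos' (fun j _ => cross_edge_nonneg hT i j)
      ⟨i + 1 + 1, Finset.mem_univ _, hT i _ h.2.1 h.2.2⟩
  rw [cross_sub_center_eq]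
  rw [← e] at hpos
  exact pos_of_mul_pos_right hpos hn0.le

theorem injective_of_isConvexCCW (hn : n = 3 ∨ n = 4) (hT : IsConvexCCW T) :
    Function.Injective T := by
  have h1 : ∀ i, T (i + 1) ≠ T i := fun i h => by
    have h := hT i (i + 1 + 1) (fin_add_one_ne hn i).2.1 (fin_add_one_ne hn i).2.2
    rw [‹T (i + 1) = T i›, sub_self, cross_zero_left] at h
    exact h.false
  intro i j hij
  by_contra hne
  rcases fin_cases_of_ne hn hne with rfl | rfl | ⟨-, rfl⟩
  · exact h1 i hij.symm
  · exact h1 j hij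
  · have h := hT i (i + 1 + 1) (fin_add_one_ne hn i).2.1 (fin_add_one_ne hn i).2.2
    rw [← hij, sub_self, cross_zero_right] at h
    exact h.false

theorem center_mem_cell (T : Fin n → Plane) : center T ∈ cell T := by
  have hn : (n : ℝ) ≠ 0 := Nat.cast_ne_zero.2 (NeZero.ne n)
  rw [center, Finset.smul_sum]
  refine (convex_convexHull ℝ _).sum_mem (fun _ _ => by positivity) ?_
    fun i _ => subset_convexHull ℝ _ (mem_range_self i)
  rw [Finset.sum_const, Finset.card_univ, Fintype.card_fin, nsmul_eq_mul, mul_inv_cancel₀ hn]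

theorem subTriangle_subset_cell (T : Fin n → Plane) (i : Fin n) : subTriangle T i ⊆ cell T := by
  refine convexHull_min ?_ (convex_convexHull ℝ _)
  rintro y (rfl | rfl | rfl)
  · exact center_mem_cell T
  · exact vertex_mem_cell T i
  · exact vertex_mem_cell T (i + 1)

-- Otherwise nonnegativity at one index would propagate, strictly, around the whole cycle and make
-- the sum positive.
open Fin.CommRing in
theorem exists_cyclic_sign_change {s : Fin n → ℝ} (hs : ∑ i, s i = 0) :
    ∃ i, 0 ≤ s i ∧ s (i + 1) ≤ 0 := by
  by_contra! h
  obtain ⟨i₀, hi₀⟩ : ∃ i, 0 ≤ s i := by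
    by_contra! h'
    exact (Finset.sum_neg (fun i _ => h' i) ⟨0, Finset.mem_univ _⟩).ne hs
  have h1 : ∀ k : ℕ, 0 ≤ s (i₀ + (k : Fin n)) := by
    intro k
    induction k with
    | zero => simpa using hi₀
    | succ k ih =>
      have := (h _ ih).le
      rwa [add_assoc, ← Nat.cast_succ] at this
  have h2 : ∀ j, 0 ≤ s j := fun j => by
    have := h1 (j - i₀).val
    rwa [Fin.cast_val_eq_self, add_sub_cancel] at this
  exact (Finset.sum_pos' (fun i _ => h2 i) ⟨i₀ + 1, Finset.mem_univ _, h i₀ hi₀⟩).ne' hs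

/-- The cross products of the rays from the center to the vertices with the ray to `x` sum to zero,
because the center is the mean of the vertices. A sign change between consecutive rays locates the
sector containing `x`. -/
theorem cell_subset_iUnion_subTriangle (hn : n = 3 ∨ n = 4) (hT : IsConvexCCW T) :
    cell T ⊆ ⋃ i, subTriangle T i := by
  intro x hx
  have hs : ∑ i, cross (T i - center T) (x - center T) = 0 := by
    simp only [← crossL_apply]
    rw [← LinearMap.sum_apply, ← map_sum, sum_sub_center, map_zero, LinearMap.zero_apply]
  obtain ⟨i, h1, h2⟩ := exists_cyclic_sign_change hs
  refine mem_iUnion.2 ⟨i, mem_triangle_of_cross (cross_center_pos hn hT i) h1 ?_ ?_⟩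
  · refine cross_nonneg_of_mem_convexHull ?_ hx
    rintro _ ⟨j, rfl⟩
    exact cross_edge_nonneg hT i j
  · simp only [cross, PiLp.sub_apply] at h2 ⊢
    linarith

theorem aedisjoint_subTriangle_add_one (hn : n = 3 ∨ n = 4) (hT : IsConvexCCW T) (i : Fin n) :
    AEDisjoint volume (subTriangle T i) (subTriangle T (i + 1)) := by
  have h1 := cross_center_pos hn hT i
  have h2 := cross_center_pos hn hT (i + 1)
  refine (aedisjoint_convexHull (ne_zero_of_cross_pos h2) (center T) ?_ ?_).symm
  · rintro y (rfl | rfl | rfl)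
    · simp [cross]
    · exact (cross_self _).ge
    · exact h2.le
  · rintro y (rfl | rfl | rfl)
    · simp [cross]
    · rw [cross_swap]; linarith
    · exact (cross_self _).le

/-- Opposite subtriangles of a quadrilateral are separated by the line through the midpoints of the
other two edges. It passes through the center, since the four vertex offsets sum to zero. -/
theorem aedisjoint_subTriangle_add_two {T : Fin 4 → Plane} (hT : IsConvexCCW T) (i : Fin 4) :
    AEDisjoint volume (subTriangle T i) (subTriangle T (i + 1 + 1)) := by
  have h1 := cross_center_pos (Or.inr rfl) hT (i + 1)
  have h3 := cross_center_pos (Or.inr rfl) hT (i + 1 + 1 + 1)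
  have hs := sum_sub_center T
  have hi : i + 1 + 1 + 1 + 1 = i := (by decide : ∀ i : Fin 4, i + 1 + 1 + 1 + 1 = i) i
  rw [hi] at h3
  rw [← Equiv.sum_comp (Equiv.addLeft i), Fin.sum_univ_four] at hs
  simp only [Equiv.coe_addLeft, add_zero] at hs
  rw [(by decide : ∀ i : Fin 4, i + 2 = i + 1 + 1) i,
    (by decide : ∀ i : Fin 4, i + 3 = i + 1 + 1 + 1) i] at hs
  have hs0 := congrArg (fun v : Plane => v 0) hs
  have hs1 := congrArg (fun v : Plane => v 1) hs
  have e0 : cross (T (i + 1) - center T + (T (i + 1 + 1) - center T)) (T i - center T)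
      = -cross (T (i + 1 + 1 + 1) - center T) (T i - center T) := by
    simp only [cross, PiLp.sub_apply, PiLp.add_apply, PiLp.zero_apply] at hs0 hs1 ⊢
    linear_combination (T i 1 - center T 1) * hs0 - (T i 0 - center T 0) * hs1
  have e3 : cross (T (i + 1) - center T + (T (i + 1 + 1) - center T))
      (T (i + 1 + 1 + 1) - center T) = cross (T (i + 1 + 1 + 1) - center T) (T i - center T) := by
    simp only [cross, PiLp.sub_apply, PiLp.add_apply, PiLp.zero_apply] at hs0 hs1 ⊢
    linear_combination (T (i + 1 + 1 + 1) 1 - center T 1) * hs0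
      - (T (i + 1 + 1 + 1) 0 - center T 0) * hs1
  have e1 : cross (T (i + 1) - center T + (T (i + 1 + 1) - center T)) (T (i + 1) - center T)
      = -cross (T (i + 1) - center T) (T (i + 1 + 1) - center T) := by
    simp only [cross, PiLp.sub_apply, PiLp.add_apply]
    ring
  have e2 : cross (T (i + 1) - center T + (T (i + 1 + 1) - center T)) (T (i + 1 + 1) - center T)
      = cross (T (i + 1) - center T) (T (i + 1 + 1) - center T) := by
    simp only [cross, PiLp.sub_apply, PiLp.add_apply]
    ring
  refine (aedisjoint_convexHull (w := T (i + 1) - center T + (T (i + 1 + 1) - center T)) ?_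
    (center T) ?_ ?_).symm
  · exact ne_zero_of_cross_pos (e2 ▸ h1)
  · rintro y (rfl | rfl | rfl)
    · simp [cross]
    · exact e2 ▸ h1.le
    · exact e3 ▸ h3.le
  · rintro y (rfl | rfl | rfl)
    · simp [cross]
    · rw [e0]; linarith
    · rw [e1]; linarith

theorem aedisjoint_subTriangle (hn : n = 3 ∨ n = 4) (hT : IsConvexCCW T) {i j : Fin n}
    (hij : i ≠ j) : AEDisjoint volume (subTriangle T i) (subTriangle T j) := by
  rcases fin_cases_of_ne hn hij with rfl | rfl | ⟨rfl, rfl⟩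
  · exact aedisjoint_subTriangle_add_one hn hT i
  · exact (aedisjoint_subTriangle_add_one hn hT j).symm
  · exact aedisjoint_subTriangle_add_two hT i

/-- The two halves of the subtriangle at the `i`-th edge. -/
def halfTriangle (T : Fin n → Plane) (i : Fin n) : Bool → Set Plane
  | false => convexHull ℝ {center T, T i, midpoint ℝ (T i) (T (i + 1))}
  | true => convexHull ℝ {center T, midpoint ℝ (T i) (T (i + 1)), T (i + 1)}

theorem isCompact_halfTriangle (T : Fin n → Plane) (i : Fin n) (b : Bool) :
    IsCompact (halfTriangle T i b) := by
  cases b <;> exact isCompact_triangle _ _ _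

theorem subTriangle_eq_union (hn : n = 3 ∨ n = 4) (hT : IsConvexCCW T) (i : Fin n) :
    subTriangle T i = halfTriangle T i false ∪ halfTriangle T i true :=
  triangle_eq_union (cross_center_pos hn hT i)

theorem halfTriangle_subset (hn : n = 3 ∨ n = 4) (hT : IsConvexCCW T) (i : Fin n) (b : Bool) :
    halfTriangle T i b ⊆ subTriangle T i := by
  rw [subTriangle_eq_union hn hT]
  cases b
  · exact subset_union_left
  · exact subset_union_right

theorem vertexCell_eq_union (T : Fin n → Plane) (i : Fin n) :
    vertexCell T i = halfTriangle T (i - 1) true ∪ halfTriangle T i false := by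
  rw [vertexCell, halfTriangle, halfTriangle, sub_add_cancel]

theorem sharesEdge_symm {T T' : Fin n → Plane} {i j : Fin n} (h : SharesEdge T T' i j) :
    SharesEdge T' T j i := ⟨h.2.symm, h.1.symm⟩

end Polygon

/-! ### The two subdivisions as partitions of the domain -/

namespace Mesh

variable {n : ℕ} [NeZero n] {Ω : Set Plane} (M : Mesh n Ω) {T T' : Fin n → Plane}

theorem aedisjoint_cell (hn : n = 3 ∨ n = 4) (hT : T ∈ M.elems) (hT' : T' ∈ M.elems)
    (h : T ≠ T') : AEDisjoint volume (cell T) (cell T') := by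
  rcases M.conforming T hT T' hT' h with h | ⟨i, j, -, h⟩ | ⟨i, j, -, h⟩
  · rw [AEDisjoint, h, measure_empty]
  · rw [AEDisjoint, h, measure_singleton]
  · rw [AEDisjoint, h]
    exact volume_segment fun e => (fin_add_one_ne hn i).1
      (injective_of_isConvexCCW hn (M.convex T hT) e).symm

theorem aedisjoint_subTriangle (hn : n = 3 ∨ n = 4) (hT : T ∈ M.elems) (hT' : T' ∈ M.elems)
    {i j : Fin n} (h : (T, i) ≠ (T', j)) :
    AEDisjoint volume (subTriangle T i) (subTriangle T' j) := by
  by_cases hTT : T = T'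
  · subst hTT
    exact SSE.aedisjoint_subTriangle hn (M.convex T hT) fun e => h (by rw [e])
  · exact (M.aedisjoint_cell hn hT hT' hTT).mono (subTriangle_subset_cell T i)
      (subTriangle_subset_cell T' j)

/-- The half triangles are a common refinement of both subdivisions: edge cells join them across
edges and across the segments to the edge midpoints, vertex cells across the segments from center to
vertex. -/
theorem aedisjoint_halfTriangle (hn : n = 3 ∨ n = 4) (hT : T ∈ M.elems) (hT' : T' ∈ M.elems)
    {i j : Fin n} {b b' : Bool} (h : (T, i, b) ≠ (T', j, b')) :
    AEDisjoint volume (halfTriangle T i b) (halfTriangle T' j b') := by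
  by_cases hTT : (T, i) = (T', j)
  · obtain ⟨rfl, rfl⟩ := Prod.mk.inj hTT
    have hbb : b ≠ b' := fun e => h (by rw [e])
    have := aedisjoint_half_triangles (cross_center_pos hn (M.convex T hT) i)
    cases b <;> cases b'
    · exact absurd rfl hbb
    · exact this.symm
    · exact this
    · exact absurd rfl hbb
  · exact (M.aedisjoint_subTriangle hn hT hT' hTT).mono
      (halfTriangle_subset hn (M.convex T hT) i b) (halfTriangle_subset hn (M.convex T' hT') j b')

/-- With equal orientation both subtriangles lie to the left of the edge and overlap in positive
area, which distinct ones cannot. Hence the neighbor across an edge is unique. -/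
theorem eq_of_edge_eq (hn : n = 3 ∨ n = 4) (hT : T ∈ M.elems) (hT' : T' ∈ M.elems)
    {i j : Fin n} (h1 : T i = T' j) (h2 : T (i + 1) = T' (j + 1)) : (T, i) = (T', j) := by
  by_contra hne
  have h := M.aedisjoint_subTriangle hn hT hT' hne
  have e : ∀ c p q : Plane, ({c, p, q} : Set Plane) = {p, q, c} := fun c p q => by
    ext x; simp only [mem_insert_iff, mem_singleton_iff]; tauto
  have c1 := cross_center_pos hn (M.convex T hT) i
  have c2 := cross_center_pos hn (M.convex T' hT') j
  rw [cross_sub_center_eq] at c1 c2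
  rw [AEDisjoint, subTriangle, subTriangle, e (center T), e (center T'), ← h1, ← h2] at h
  rw [← h1, ← h2] at c2
  exact volume_triangle_inter_ne_zero c1 c2 h

theorem edgeCell_eq_of_sharesEdge (hn : n = 3 ∨ n = 4) (hT' : T' ∈ M.elems)
    {i j : Fin n} (h : SharesEdge T T' i j) :
    M.edgeCell T i = subTriangle T i ∪ subTriangle T' j := by
  rw [edgeCell]
  congr 1
  apply Subset.antisymm
  · intro x hx
    simp only [mem_iUnion] at hx
    obtain ⟨S, hS, k, hk, hx⟩ := hx
    obtain ⟨rfl, rfl⟩ := Prod.mk.inj (M.eq_of_edge_eq hn hS hT' (hk.2.symm.trans h.2)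
      (hk.1.symm.trans h.1))
    exact hx
  · intro x hx
    simp only [mem_iUnion]
    exact ⟨T', hT', j, h, hx⟩

theorem edgeCell_congr (hn : n = 3 ∨ n = 4) (hT : T ∈ M.elems) (hT' : T' ∈ M.elems)
    {i j : Fin n} (h : SharesEdge T T' i j) : M.edgeCell T i = M.edgeCell T' j := by
  rw [M.edgeCell_eq_of_sharesEdge hn hT' h,
    M.edgeCell_eq_of_sharesEdge hn hT (sharesEdge_symm h), union_comm]

theorem edgeCell_eq_or (hn : n = 3 ∨ n = 4) (T : Fin n → Plane) (i : Fin n) :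
    M.edgeCell T i = subTriangle T i ∨ ∃ T' ∈ M.elems, ∃ j, SharesEdge T T' i j ∧
      M.edgeCell T i = subTriangle T i ∪ subTriangle T' j := by
  by_cases h : ∃ T' ∈ M.elems, ∃ j, SharesEdge T T' i j
  · obtain ⟨T', hT', j, h⟩ := h
    exact Or.inr ⟨T', hT', j, h, M.edgeCell_eq_of_sharesEdge hn hT' h⟩
  · left
    rw [edgeCell, union_eq_left]
    intro x hx
    simp only [mem_iUnion] at hx
    obtain ⟨S, hS, k, hk, hx⟩ := hx
    exact absurd ⟨S, hS, k, hk⟩ h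

theorem subTriangle_subset_edgeCell (T : Fin n → Plane) (i : Fin n) :
    subTriangle T i ⊆ M.edgeCell T i := subset_union_left

/-- An edge cell is the same set seen from either side, so different edge cells are built from
different subtriangles. -/
theorem aedisjoint_edgeCell (hn : n = 3 ∨ n = 4) (hT : T ∈ M.elems) (hT' : T' ∈ M.elems)
    {i j : Fin n} (h : M.edgeCell T i ≠ M.edgeCell T' j) :
    AEDisjoint volume (M.edgeCell T i) (M.edgeCell T' j) := by
  have key : ∀ S ∈ M.elems, ∀ S' ∈ M.elems, ∀ k l, M.edgeCell S k ≠ M.edgeCell S' l →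
      AEDisjoint volume (subTriangle S k) (subTriangle S' l) := fun S hS S' hS' k l hne =>
    M.aedisjoint_subTriangle hn hS hS' fun e => hne (by rw [(Prod.mk.inj e).1, (Prod.mk.inj e).2])
  have h0 := key T hT T' hT' i j h
  rcases M.edgeCell_eq_or hn T i with e | ⟨S, hS, k, hk, e⟩ <;>
  rcases M.edgeCell_eq_or hn T' j with e' | ⟨S', hS', k', hk', e'⟩
  · rwa [e, e']
  · rw [e, e', AEDisjoint.union_right_iff]
    exact ⟨h0, key T hT S' hS' i k' (by rwa [← M.edgeCell_congr hn hT' hS' hk'])⟩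
  · rw [e, e', AEDisjoint.union_left_iff]
    exact ⟨h0, key S hS T' hT' k j (by rwa [← M.edgeCell_congr hn hT hS hk])⟩
  · rw [e, e', AEDisjoint.union_left_iff, AEDisjoint.union_right_iff, AEDisjoint.union_right_iff]
    refine ⟨⟨h0, key T hT S' hS' i k' (by rwa [← M.edgeCell_congr hn hT' hS' hk'])⟩,
      key S hS T' hT' k j (by rwa [← M.edgeCell_congr hn hT hS hk]),
      key S hS S' hS' k k' ?_⟩
    rwa [← M.edgeCell_congr hn hT' hS' hk', ← M.edgeCell_congr hn hT hS hk]

theorem exists_mem_halfTriangle (hn : n = 3 ∨ n = 4) {x : Plane} (hx : x ∈ closure Ω) :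
    ∃ T ∈ M.elems, ∃ i b, x ∈ halfTriangle T i b := by
  rw [← M.cover] at hx
  simp only [mem_iUnion] at hx
  obtain ⟨T, hT, hx⟩ := hx
  obtain ⟨i, hi⟩ := mem_iUnion.1 (cell_subset_iUnion_subTriangle hn (M.convex T hT) hx)
  rw [subTriangle_eq_union hn (M.convex T hT)] at hi
  rcases hi with hi | hi
  · exact ⟨T, hT, i, false, hi⟩
  · exact ⟨T, hT, i, true, hi⟩

theorem edgeCell_mem (hT : T ∈ M.elems) (i : Fin n) : M.edgeCell T i ∈ M.edgeMesh.cells := by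
  classical
  exact Finset.mem_image.2 ⟨(T, i), Finset.mem_product.2 ⟨hT, Finset.mem_univ _⟩, rfl⟩

theorem vertexCell_mem (hT : T ∈ M.elems) (i : Fin n) : vertexCell T i ∈ M.vertexMesh.cells := by
  classical
  exact Finset.mem_image.2 ⟨(T, i), Finset.mem_product.2 ⟨hT, Finset.mem_univ _⟩, rfl⟩

theorem exists_of_mem_edgeMesh {K : Set Plane} (hK : K ∈ M.edgeMesh.cells) :
    ∃ T ∈ M.elems, ∃ i, M.edgeCell T i = K := by
  classical
  obtain ⟨p, hp, rfl⟩ := Finset.mem_image.1 hK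
  exact ⟨p.1, (Finset.mem_product.1 hp).1, p.2, rfl⟩

theorem exists_of_mem_vertexMesh {K : Set Plane} (hK : K ∈ M.vertexMesh.cells) :
    ∃ T ∈ M.elems, ∃ i, vertexCell T i = K := by
  classical
  obtain ⟨p, hp, rfl⟩ := Finset.mem_image.1 hK
  exact ⟨p.1, (Finset.mem_product.1 hp).1, p.2, rfl⟩

theorem edgeMesh_isPartition (hn : n = 3 ∨ n = 4) (hΩ : IsOpen Ω) : M.edgeMesh.IsPartition Ω where
  aedisjoint := by
    intro K hK L hL hne
    obtain ⟨T, hT, i, rfl⟩ := M.exists_of_mem_edgeMesh hK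
    obtain ⟨T', hT', j, rfl⟩ := M.exists_of_mem_edgeMesh hL
    exact Measure.absolutelyContinuous_of_le Measure.restrict_le_self
      (M.aedisjoint_edgeCell hn hT hT' hne)
  cover := by
    filter_upwards [ae_restrict_mem hΩ.measurableSet] with x hx
    obtain ⟨T, hT, i, b, h⟩ := M.exists_mem_halfTriangle hn (subset_closure hx)
    exact ⟨_, M.edgeCell_mem hT i, M.subTriangle_subset_edgeCell T i
      (halfTriangle_subset hn (M.convex T hT) i b h)⟩

theorem vertexMesh_isPartition (hn : n = 3 ∨ n = 4) (hΩ : IsOpen Ω) :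
    M.vertexMesh.IsPartition Ω where
  aedisjoint := by
    intro K hK L hL hne
    obtain ⟨T, hT, i, rfl⟩ := M.exists_of_mem_vertexMesh hK
    obtain ⟨T', hT', j, rfl⟩ := M.exists_of_mem_vertexMesh hL
    have h1 : (T, i) ≠ (T', j) := fun e => hne (by rw [(Prod.mk.inj e).1, (Prod.mk.inj e).2])
    refine Measure.absolutelyContinuous_of_le Measure.restrict_le_self ?_
    change AEDisjoint volume (vertexCell T i) (vertexCell T' j)
    rw [vertexCell_eq_union, vertexCell_eq_union, AEDisjoint.union_left_iff,
      AEDisjoint.union_right_iff, AEDisjoint.union_right_iff]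
    refine ⟨⟨?_, ?_⟩, ?_, ?_⟩ <;> apply M.aedisjoint_halfTriangle hn hT hT' <;> intro e <;>
      simp_all
  cover := by
    filter_upwards [ae_restrict_mem hΩ.measurableSet] with x hx
    obtain ⟨T, hT, i, b, h⟩ := M.exists_mem_halfTriangle hn (subset_closure hx)
    cases b
    · exact ⟨_, M.vertexCell_mem hT i, by rw [vertexCell_eq_union]; exact Or.inr h⟩
    -- The second half at edge `i` belongs to the endpoint `i + 1`.
    · refine ⟨_, M.vertexCell_mem hT (i + 1), ?_⟩
      rw [vertexCell_eq_union, add_sub_cancel_right]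
      exact Or.inl h

end Mesh

/-! ### Strains of finite element functions on triangular meshes -/

section LocalEstimate

/-- The quadratic form `dᵀ e d` of a strain tensor `e` in Voigt notation, as a linear functional
of `e`. -/
def normalStrain (d : Plane) : Voigt →L[ℝ] ℝ :=
  LinearMap.toContinuousLinearMap
    { toFun := fun e => e 0 * d 0 ^ 2 + e 1 * d 1 ^ 2 + e 2 * (d 0 * d 1)
      map_add' := fun e e' => by simp only [PiLp.add_apply]; ring
      map_smul' := fun r e => by
        simp only [PiLp.smul_apply, smul_eq_mul, RingHom.id_apply]; ring }

theorem normalStrain_apply (d : Plane) (e : Voigt) :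
    normalStrain d e = e 0 * d 0 ^ 2 + e 1 * d 1 ^ 2 + e 2 * (d 0 * d 1) := rfl

theorem normalStrain_neg (d : Plane) (e : Voigt) : normalStrain (-d) e = normalStrain d e := by
  simp only [normalStrain_apply, PiLp.neg_apply]
  ring

theorem abs_normalStrain_le {d : Plane} {h : ℝ} (h0 : |d 0| ≤ h) (h1 : |d 1| ≤ h) (e : Voigt) :
    |normalStrain d e| ≤ 3 * h ^ 2 * ‖e‖ := by
  have hh : 0 ≤ h := (abs_nonneg _).trans h0
  have he : ∀ i, |e i| ≤ ‖e‖ := fun i => PiLp.norm_apply_le e i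
  rw [normalStrain_apply]
  refine (abs_add_three _ _ _).trans ?_
  have b0 : |e 0 * d 0 ^ 2| ≤ ‖e‖ * h ^ 2 := by
    rw [abs_mul, abs_pow]
    gcongr
    exact he 0
  have b1 : |e 1 * d 1 ^ 2| ≤ ‖e‖ * h ^ 2 := by
    rw [abs_mul, abs_pow]
    gcongr
    exact he 1
  have b2 : |e 2 * (d 0 * d 1)| ≤ ‖e‖ * (h * h) := by
    rw [abs_mul, abs_mul]
    gcongr
    exact he 2
  nlinarith

/-- A symmetric tensor is recovered by polarization from its quadratic form at `X`, `Y` and `X + Y`.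
Cramer's rule brings in the squared determinant, and the factor 10 is dictated by the shear
component. -/
theorem abs_coord_le_of_normalStrain_le {X Y : Plane} {h R : ℝ} (hX : ∀ i, |X i| ≤ h)
    (hY : ∀ i, |Y i| ≤ h) {e : Voigt} (eX : |normalStrain X e| ≤ R) (eY : |normalStrain Y e| ≤ R)
    (eZ : |normalStrain (X + Y) e| ≤ R) (i : Fin 3) : cross X Y ^ 2 * |e i| ≤ 10 * h ^ 2 * R := by
  have hh : 0 ≤ h := (abs_nonneg _).trans (hX 0)
  have hR : 0 ≤ R := (abs_nonneg _).trans eX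
  -- Twice the mixed term of the quadratic form.
  set P := normalStrain (X + Y) e - normalStrain X e - normalStrain Y e with hP
  have eP : |P| ≤ 3 * R := by
    rw [abs_le] at *
    constructor <;> linarith
  have term : ∀ {u v w c : ℝ}, |u| ≤ h → |v| ≤ h → |w| ≤ c → |u * v * w| ≤ h ^ 2 * c :=
    fun {u v w c} hu hv hw => by
      rw [abs_mul, abs_mul, sq]
      gcongr
  have i0 : cross X Y ^ 2 * e 0 = Y 1 * Y 1 * normalStrain X e - X 1 * Y 1 * P
      + X 1 * X 1 * normalStrain Y e := by
    simp only [hP, normalStrain_apply, PiLp.add_apply, cross]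
    ring
  have i1 : cross X Y ^ 2 * e 1 = Y 0 * Y 0 * normalStrain X e - X 0 * Y 0 * P
      + X 0 * X 0 * normalStrain Y e := by
    simp only [hP, normalStrain_apply, PiLp.add_apply, cross]
    ring
  have i2 : cross X Y ^ 2 * e 2 = -2 * (Y 0 * Y 1 * normalStrain X e) + X 0 * Y 1 * P
      + X 1 * Y 0 * P - 2 * (X 0 * X 1 * normalStrain Y e) := by
    simp only [hP, normalStrain_apply, PiLp.add_apply, cross]
    ring
  have ha : ∀ j, cross X Y ^ 2 * |e j| = |cross X Y ^ 2 * e j| := fun j => by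
    rw [abs_mul, abs_of_nonneg (sq_nonneg (cross X Y))]
  have hhR : 0 ≤ h ^ 2 * R := by positivity
  rw [ha]
  fin_cases i
  · have t1 := abs_le.1 (term (hY 1) (hY 1) eX)
    have t2 := abs_le.1 (term (hX 1) (hY 1) eP)
    have t3 := abs_le.1 (term (hX 1) (hX 1) eY)
    simp only [Fin.zero_eta, Fin.isValue]
    rw [i0, abs_le]
    constructor <;> linarith
  · have t1 := abs_le.1 (term (hY 0) (hY 0) eX)
    have t2 := abs_le.1 (term (hX 0) (hY 0) eP)
    have t3 := abs_le.1 (term (hX 0) (hX 0) eY)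
    simp only [Fin.mk_one, Fin.isValue]
    rw [i1, abs_le]
    constructor <;> linarith
  · have t1 := abs_le.1 (term (hY 0) (hY 1) eX)
    have t2 := abs_le.1 (term (hX 0) (hY 1) eP)
    have t4 := abs_le.1 (term (hX 1) (hY 0) eP)
    have t3 := abs_le.1 (term (hX 0) (hX 1) eY)
    simp only [Fin.reduceFinMk, Fin.isValue]
    rw [i2, abs_le]
    constructor <;> linarith

/-- A strain tensor is bounded by the pairwise means of three tensors that have the same normal
strains along the edges of a triangle. -/
theorem norm_sq_le_of_normalStrain_eq {T : Fin 3 → Plane} {h k : ℝ}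
    (hh : ∀ i j, |(T (i + 1) - T i) j| ≤ h) (hJ0 : 0 < cross (T 1 - T 0) (T 2 - T 1))
    (hJ : h ^ 2 ≤ k * cross (T 1 - T 0) (T 2 - T 1)) {e : Voigt} {a b : Fin 3 → Voigt}
    (ha : ∀ i, normalStrain (T (i + 1) - T i) e = normalStrain (T (i + 1) - T i) (a i))
    (hb : ∀ i, b i = (2⁻¹ : ℝ) • (a (i - 1) + a i)) :
    ‖e‖ ^ 2 ≤ 8100 * k ^ 4 * ∑ i, ‖b i‖ ^ 2 := by
  set J := cross (T 1 - T 0) (T 2 - T 1) with hJdef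
  set N := ‖b 0‖ + ‖b 1‖ + ‖b 2‖ with hN
  have hN0 : 0 ≤ N := by positivity
  have b0 := hb 0
  have b1 := hb 1
  have b2 := hb 2
  rw [show (0 : Fin 3) - 1 = 2 from rfl] at b0
  rw [show (1 : Fin 3) - 1 = 0 from rfl] at b1
  rw [show (2 : Fin 3) - 1 = 1 from rfl] at b2
  have aN : ∀ i, ‖a i‖ ≤ N := by
    have tri : ∀ x y z : Voigt, ‖x + y - z‖ ≤ ‖x‖ + ‖y‖ + ‖z‖ := fun x y z =>
      (norm_sub_le _ _).trans (add_le_add (norm_add_le _ _) le_rfl)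
    -- Taking means of neighbors is invertible on a cycle of odd length.
    have a0 : a 0 = b 0 + b 1 - b 2 := by rw [b0, b1, b2]; module
    have a1 : a 1 = b 1 + b 2 - b 0 := by rw [b0, b1, b2]; module
    have a2 : a 2 = b 2 + b 0 - b 1 := by rw [b0, b1, b2]; module
    intro i
    fin_cases i
    · exact a0 ▸ tri _ _ _
    · refine (a1 ▸ tri _ _ _ : ‖a 1‖ ≤ _).trans (le_of_eq ?_)
      rw [hN]; ring
    · refine (a2 ▸ tri _ _ _ : ‖a 2‖ ≤ _).trans (le_of_eq ?_)
      rw [hN]; ring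
  have hR : ∀ i, |normalStrain (T (i + 1) - T i) e| ≤ 3 * h ^ 2 * N := fun i => by
    rw [ha i]
    refine (abs_normalStrain_le (hh i 0) (hh i 1) (a i)).trans ?_
    gcongr
    exact aN i
  -- The third edge plays the role of `X + Y`; its sign is irrelevant to a quadratic form.
  have e2 : T (2 + 1) - T 2 = -((T 1 - T 0) + (T 2 - T 1)) := by
    rw [show (2 : Fin 3) + 1 = 0 from rfl]; abel
  have hR2 := hR 2
  rw [e2, normalStrain_neg] at hR2
  have hcoord : ∀ i, |e i| ≤ 30 * k ^ 2 * N := fun i => by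
    have h1 := abs_coord_le_of_normalStrain_le (fun j => hh 0 j) (fun j => hh 1 j) (hR 0) (hR 1)
      hR2 i
    have h2 : h ^ 2 * h ^ 2 ≤ (k * J) * (k * J) := mul_self_le_mul_self (sq_nonneg h) hJ
    change J ^ 2 * |e i| ≤ _ at h1
    have h3 : J ^ 2 * |e i| ≤ J ^ 2 * (30 * k ^ 2 * N) := by nlinarith
    exact le_of_mul_le_mul_left h3 (by positivity)
  have hsq : ∀ i, e i ^ 2 ≤ 900 * k ^ 4 * N ^ 2 := fun i => by
    have := sq_le_sq' (neg_le_of_abs_le (hcoord i)) (le_of_abs_le (hcoord i))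
    linarith [this, (by ring : (30 * k ^ 2 * N) ^ 2 = 900 * k ^ 4 * N ^ 2)]
  have hNsq : N ^ 2 ≤ 3 * ∑ i, ‖b i‖ ^ 2 := by
    rw [Fin.sum_univ_three]
    nlinarith [sq_nonneg (‖b 0‖ - ‖b 1‖), sq_nonneg (‖b 1‖ - ‖b 2‖), sq_nonneg (‖b 0‖ - ‖b 2‖)]
  rw [EuclideanSpace.real_norm_sq_eq, Fin.sum_univ_three]
  have hk4 : 0 ≤ k ^ 4 := by positivity
  -- Three coordinates, each at most `900 k⁴ N²`, and `N²` at most three times the sum of squares: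
  -- hence 8100.
  nlinarith [hsq 0, hsq 1, hsq 2, mul_le_mul_of_nonneg_left hNsq hk4]

/-- The constant strain of an affine displacement. -/
def affineStrain (A : Plane →ᵃ[ℝ] Plane) : Voigt := ∑ i, strainMap i (A.linear (unitVec i))

theorem normalStrain_affineStrain (A : Plane →ᵃ[ℝ] Plane) (p q : Plane) :
    normalStrain (q - p) (affineStrain A) = inner ℝ (q - p) (A q - A p) := by
  have h0 : A q - A p = A.linear (q - p) := by
    rw [← vsub_eq_sub q p, AffineMap.linearMap_vsub, vsub_eq_sub]
  set d := q - p
  have hd : d = d 0 • unitVec 0 + d 1 • unitVec 1 := by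
    ext i; fin_cases i <;> simp [unitVec]
  have h1 : A.linear d = d 0 • A.linear (unitVec 0) + d 1 • A.linear (unitVec 1) := by
    conv_lhs => rw [hd]
    rw [map_add, map_smul, map_smul]
  rw [h0, h1, affineStrain, normalStrain_apply]
  simp [strainMap, strainMatrix, Matrix.toLpLin_apply, Fin.sum_univ_two, dotProduct, PiLp.inner_apply]
  ring

end LocalEstimate

/-! ### Weak gradients of piecewise affine fields -/

section WeakDerivative

variable {Ω : Set Plane}

theorem integral_smul_affine_linear (A : Plane →ᵃ[ℝ] Plane) {φ : Plane → ℝ}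
    (hφ : ContDiff ℝ ∞ φ) (hc : HasCompactSupport φ) (v : Plane) :
    ∫ x, φ x • A.linear v = -∫ x, fderiv ℝ φ x v • A x := by
  have hA : Continuous A := A.continuous_of_finiteDimensional
  have hd : Continuous fun x => fderiv ℝ φ x v :=
    (hφ.continuous_fderiv (by simp)).clm_apply continuous_const
  have hdc : HasCompactSupport fun x => fderiv ℝ φ x v := hc.fderiv_apply (𝕜 := ℝ) v
  refine integral_bilinear_hasLineDerivAt_right_eq_neg_left_of_integrable (μ := volume)
    (f := φ) (f' := fun x => fderiv ℝ φ x v) (g := A) (g' := fun _ => A.linear v) (v := v)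
    (B := ContinuousLinearMap.lsmul ℝ ℝ) ?_ ?_ ?_ ?_ ?_
  · exact (hd.smul hA).integrable_of_hasCompactSupport hdc.smul_right
  · exact (hφ.continuous.smul continuous_const).integrable_of_hasCompactSupport hc.smul_right
  · exact (hφ.continuous.smul hA).integrable_of_hasCompactSupport hc.smul_right
  · intro x _
    exact ((hφ.differentiable (by simp)) x).hasFDerivAt.hasLineDerivAt v
  · intro x _
    have h : HasFDerivAt A (LinearMap.toContinuousLinearMap A.linear) x := by
      have e : (A : Plane → Plane) = fun y => LinearMap.toContinuousLinearMap A.linear y + A 0 := by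
        ext1 y
        exact congrFun A.decomp y
      rw [e]
      exact ((LinearMap.toContinuousLinearMap A.linear).hasFDerivAt).add_const _
    exact h.hasLineDerivAt v

/-- Test functions supported in `U` see only the affine function, so classical integration by parts
and the fundamental lemma of the calculus of variations identify the weak gradient there. -/
theorem weakGradient_ae_eq {w : VecField Ω × (Fin 2 → VecField Ω)}
    (hw : IsWeakGradient Ω w) {U : Set Plane} (hU : IsOpen U) (hUΩ : U ⊆ Ω)
    {A : Plane →ᵃ[ℝ] Plane} (hA : ∀ᵐ x ∂(volume.restrict Ω), x ∈ U → w.1 x = A x) (i : Fin 2) :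
    ∀ᵐ x ∂(volume.restrict Ω), x ∈ U → w.2 i x = A.linear (unitVec i) := by
  have hloc : LocallyIntegrable (fun x => w.2 i x - A.linear (unitVec i)) (volume.restrict Ω) :=
    ((Lp.memLp (w.2 i)).locallyIntegrable one_le_two).sub (locallyIntegrable_const _)
  have h := hU.ae_eq_zero_of_integral_contDiff_smul_eq_zero (hloc.locallyIntegrableOn U) ?_
  · filter_upwards [h] with x hx hxU
    exact sub_eq_zero.1 (hx hxU)
  intro φ hφ hc hsupp
  have hv := hw φ hφ hc (hsupp.trans hUΩ) i
  have hint : Integrable (fun x => φ x • A.linear (unitVec i)) (volume.restrict Ω) :=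
    ((hφ.continuous.smul continuous_const).integrable_of_hasCompactSupport hc.smul_right).restrict
  have e1 : ∫ x in Ω, fderiv ℝ φ x (unitVec i) • w.1 x
      = ∫ x in Ω, fderiv ℝ φ x (unitVec i) • A x := by
    refine integral_congr_ae ?_
    filter_upwards [hA] with x hx
    by_cases hxU : x ∈ U
    · rw [hx hxU]
    · have h0 : fderiv ℝ φ x = 0 :=
        image_eq_zero_of_notMem_tsupport fun h' => hxU (hsupp (tsupport_fderiv_subset ℝ h'))
      rw [h0, zero_apply, zero_smul, zero_smul]
  have e2 : ∫ x in Ω, fderiv ℝ φ x (unitVec i) • A x = ∫ x, fderiv ℝ φ x (unitVec i) • A x := by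
    refine setIntegral_eq_integral_of_forall_compl_eq_zero fun x hx => ?_
    have h0 : fderiv ℝ φ x = 0 := image_eq_zero_of_notMem_tsupport
      fun h' => hx (hUΩ (hsupp (tsupport_fderiv_subset ℝ h')))
    rw [h0, zero_apply, zero_smul]
  have e3 : ∫ x in Ω, φ x • A.linear (unitVec i) = ∫ x, φ x • A.linear (unitVec i) := by
    refine setIntegral_eq_integral_of_forall_compl_eq_zero fun x hx => ?_
    rw [image_eq_zero_of_notMem_tsupport fun h' => hx (hUΩ (hsupp h')), zero_smul]
  simp only [smul_sub]
  rw [integral_sub (integrable_smul_of_continuous hφ.continuous hc _) hint, e3,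
    integral_smul_affine_linear A hφ hc, ← e2, ← e1, hv, neg_neg, sub_self]

end WeakDerivative

/-! ### Measure and averages on cells inside the domain -/

section Restrict

variable {Ω : Set Plane} {K C : Set Plane}

/-- Without slits the interior of an element lies in `Ω`, and the boundary of a convex set is null;
so restricting to `Ω` loses no area. -/
theorem volume_restrict_of_subset_convex (hΩ : interior (closure Ω) = Ω) (hC : Convex ℝ C)
    (hCc : IsClosed C) (hCΩ : C ⊆ closure Ω) (hK : MeasurableSet K) (hKC : K ⊆ C) :
    volume.restrict Ω K = volume K := by
  rw [Measure.restrict_apply hK]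
  refine measure_congr ?_
  have h0 : volume (frontier C) = 0 := hC.addHaar_frontier volume
  filter_upwards [measure_eq_zero_iff_ae_notMem.1 h0] with x hx
  refine propext ⟨fun h => h.1, fun h => ⟨h, ?_⟩⟩
  rw [← hΩ]
  refine interior_mono hCΩ ?_
  by_contra h'
  rw [hCc.frontier_eq] at hx
  exact hx ⟨hKC h, h'⟩

theorem ae_mem_interior_of_mem (Ω : Set Plane) (hC : Convex ℝ C) (hCc : IsClosed C) :
    ∀ᵐ x ∂(volume.restrict Ω), x ∈ C → x ∈ interior C := by
  have h0 : volume (frontier C) = 0 := hC.addHaar_frontier volume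
  filter_upwards [ae_restrict_of_ae (measure_eq_zero_iff_ae_notMem.1 h0)] with x hx h
  by_contra h'
  rw [hCc.frontier_eq] at hx
  exact hx ⟨h, h'⟩

theorem isCompact_cell {n : ℕ} (T : Fin n → Plane) : IsCompact (cell T) :=
  (finite_range T).isCompact_convexHull ℝ

theorem setAverage_eq_of_ae {μ : Measure Plane} {f : Plane → Voigt} {c : Voigt}
    (hK : MeasurableSet K) (h0 : μ K ≠ 0) (h1 : μ K ≠ ⊤) (h : ∀ᵐ x ∂μ, x ∈ K → f x = c) :
    ⨍ x in K, f x ∂μ = c := by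
  rw [setAverage_congr_fun hK h, setAverage_const h0 h1]

/-- Linear functionals commute with averaging, so a component of `f` that is constant on `K` is
preserved even where `f` itself jumps. -/
theorem clm_setAverage_eq_of_ae {μ : Measure Plane} {f : Plane → Voigt} {c : ℝ}
    (L : Voigt →L[ℝ] ℝ) (hK : MeasurableSet K) (h0 : μ K ≠ 0) (h1 : μ K ≠ ⊤)
    (hf : IntegrableOn f K μ) (h : ∀ᵐ x ∂μ, x ∈ K → L (f x) = c) :
    L (⨍ x in K, f x ∂μ) = c := by
  rw [setAverage_eq, map_smul, ← L.integral_comp_comm hf, ← setAverage_eq,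
    setAverage_congr_fun hK h, setAverage_const h0 h1]

end Restrict

/-! ### Areas and constant strains on triangles -/

section Triangles

variable {Ω ΓD : Set Plane} (M : Mesh 3 Ω) {T : Fin 3 → Plane}

/-- The centroid cuts a triangle into three subtriangles of equal area; hence all six half triangles
have equal area. -/
theorem cross_half_center (T : Fin 3 → Plane) (i : Fin 3) :
    cross (T i - center T) (T (i + 1) - center T) = cross (T 1 - T 0) (T 2 - T 1) / 3 := by
  have e0 : (0 : Fin 3) + 1 = 1 := rfl
  have e1 : (1 : Fin 3) + 1 = 2 := rfl
  have e2 : (2 : Fin 3) + 1 = 0 := rfl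
  fin_cases i <;>
  · simp only [Fin.zero_eta, Fin.mk_one, Fin.reduceFinMk, e0, e1, e2, center, Fin.sum_univ_three,
      cross, PiLp.sub_apply, PiLp.add_apply, PiLp.smul_apply, smul_eq_mul]
    push_cast
    ring

theorem volume_halfTriangle (T : Fin 3 → Plane) (i : Fin 3) (b : Bool) :
    volume (halfTriangle T i b)
      = ENNReal.ofReal |cross (T 1 - T 0) (T 2 - T 1) / 6| * volume unitTriangle := by
  have h := cross_half_center T i
  cases b <;>
  · rw [halfTriangle, volume_triangle]
    congr 3
    rw [show cross (T 1 - T 0) (T 2 - T 1) / 6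
      = (cross (T i - center T) (T (i + 1) - center T)) / 2 by rw [h]; ring]
    simp only [midpoint_eq_smul_add, cross, PiLp.sub_apply, PiLp.smul_apply, PiLp.add_apply,
      smul_eq_mul, invOf_eq_inv]
    ring

theorem volume_cell (T : Fin 3 → Plane) :
    volume (cell T) = ENNReal.ofReal |cross (T 1 - T 0) (T 2 - T 1)| * volume unitTriangle := by
  have e : range T = {T 0, T 1, T 2} := by
    ext x
    simp only [mem_range, Fin.exists_fin_succ, mem_insert_iff, mem_singleton_iff]
    simp [eq_comm]
  rw [cell, e, volume_triangle]
  congr 3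
  simp only [cross, PiLp.sub_apply]
  ring

theorem cross_pos_of_isConvexCCW (hT : IsConvexCCW T) : 0 < cross (T 1 - T 0) (T 2 - T 1) := by
  have h := cross_center_pos (Or.inl rfl) hT 0
  rw [cross_half_center] at h
  linarith

theorem cell_subset_closure (hT : T ∈ M.elems) : cell T ⊆ closure Ω := by
  rw [← M.cover]
  exact subset_biUnion_of_mem (u := fun T => cell T) hT

theorem volume_restrict_halfTriangle (hΩ : interior (closure Ω) = Ω) (hT : T ∈ M.elems)
    (i : Fin 3) (b : Bool) : volume.restrict Ω (halfTriangle T i b)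
      = ENNReal.ofReal |cross (T 1 - T 0) (T 2 - T 1) / 6| * volume unitTriangle := by
  rw [← volume_halfTriangle T i b]
  exact volume_restrict_of_subset_convex hΩ (convex_convexHull ℝ _) (isCompact_cell T).isClosed
    (cell_subset_closure M hT) (isCompact_halfTriangle T i b).measurableSet
    ((halfTriangle_subset (Or.inl rfl) (M.convex T hT) i b).trans (subTriangle_subset_cell T i))

theorem volume_restrict_halfTriangle_ne_zero (hΩ : interior (closure Ω) = Ω) (hT : T ∈ M.elems)
    (i : Fin 3) (b : Bool) : volume.restrict Ω (halfTriangle T i b) ≠ 0 := by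
  rw [volume_restrict_halfTriangle M hΩ hT]
  have := cross_pos_of_isConvexCCW (M.convex T hT)
  refine mul_ne_zero ?_ volume_unitTriangle_ne_zero
  rw [Ne, ENNReal.ofReal_eq_zero, not_le]
  positivity

theorem strain_ae_eq (hΩ : interior (closure Ω) = Ω) (v : dispSpace Ω ΓD)
    {p : Plane → Plane} (hvp : ∀ᵐ x ∂(volume.restrict Ω), v.1.1 x = p x) (hT : T ∈ M.elems)
    {A : Plane →ᵃ[ℝ] Plane} (hA : EqOn p A (cell T)) :
    ∀ᵐ x ∂(volume.restrict Ω), x ∈ cell T → strain v x = affineStrain A := by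
  have hU : interior (cell T) ⊆ Ω := by
    rw [← hΩ]
    exact interior_mono (cell_subset_closure M hT)
  have hg : ∀ᵐ x ∂(volume.restrict Ω), ∀ i, x ∈ interior (cell T) →
      v.1.2 i x = A.linear (unitVec i) := by
    refine ae_all_iff.2 fun i => weakGradient_ae_eq v.2.1 isOpen_interior hU ?_ i
    filter_upwards [hvp] with x hx hxU
    rw [hx, hA (interior_subset hxU)]
  have hs : ∀ᵐ x ∂(volume.restrict Ω), strain v x
      = ∑ i, ((strainMap i).compLp (v.1.2 i) : StrainField Ω) x := Lp.coeFn_fun_finsetSum _ _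
  have hs' : ∀ᵐ x ∂(volume.restrict Ω), ∀ i, ((strainMap i).compLp (v.1.2 i) : StrainField Ω) x
      = strainMap i (v.1.2 i x) := ae_all_iff.2 fun i => ContinuousLinearMap.coeFn_compLp _ _
  filter_upwards [ae_mem_interior_of_mem Ω (convex_convexHull ℝ (range T))
    (isCompact_cell T).isClosed, hg, hs, hs'] with x h1 h2 h3 h4 hx
  rw [h3, affineStrain]
  exact Finset.sum_congr rfl fun i _ => by rw [h4, h2 i (h1 hx)]

end Triangles

/-! ### The strain is bounded by the smoothed strain -/

section Stability

variable {Ω ΓD : Set Plane} (M : Mesh 3 Ω) {T : Fin 3 → Plane}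

theorem vertexCell_average_eq (hΩ : interior (closure Ω) = Ω) (hT : T ∈ M.elems) (i : Fin 3)
    {δ : StrainField Ω} {a : Fin 3 → Voigt}
    (hδ : ∀ i, ∀ᵐ x ∂(volume.restrict Ω), x ∈ subTriangle T i → δ x = a i) :
    ⨍ x in vertexCell T i, δ x ∂(volume.restrict Ω) = (2⁻¹ : ℝ) • (a (i - 1) + a i) := by
  have hc : ∀ j b, IsCompact (halfTriangle T j b) := isCompact_halfTriangle T
  have hne : ∀ j b, volume.restrict Ω (halfTriangle T j b) ≠ 0 :=
    volume_restrict_halfTriangle_ne_zero M hΩ hT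
  have hav : ∀ j b, ⨍ x in halfTriangle T j b, δ x ∂(volume.restrict Ω) = a j := fun j b => by
    refine setAverage_eq_of_ae (hc j b).measurableSet (hne j b)
      (measure_restrict_ne_top Ω (hc j b)) ?_
    filter_upwards [hδ j] with x hx h
    exact hx (halfTriangle_subset (Or.inl rfl) (M.convex T hT) j b h)
  have hreal : (volume.restrict Ω).real (halfTriangle T i false)
      = (volume.restrict Ω).real (halfTriangle T (i - 1) true) := by
    rw [measureReal_def, measureReal_def, volume_restrict_halfTriangle M hΩ hT,
      volume_restrict_halfTriangle M hΩ hT]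
  have hpos : 0 < (volume.restrict Ω).real (halfTriangle T (i - 1) true) :=
    ENNReal.toReal_pos (hne _ _) (measure_restrict_ne_top Ω (hc _ _))
  have hd : AEDisjoint (volume.restrict Ω) (halfTriangle T (i - 1) true)
      (halfTriangle T i false) := by
    refine Measure.absolutelyContinuous_of_le Measure.restrict_le_self ?_
    exact M.aedisjoint_halfTriangle (Or.inl rfl) hT hT (by simp)
  rw [vertexCell_eq_union, average_union hd (hc _ _).measurableSet.nullMeasurableSet
    (measure_restrict_ne_top Ω (hc _ _)) (measure_restrict_ne_top Ω (hc _ _))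
    (integrableOn_strainField (hc _ _) δ) (integrableOn_strainField (hc _ _) δ), hav, hav, hreal,
    smul_add]
  have e : (volume.restrict Ω).real (halfTriangle T (i - 1) true) /
      ((volume.restrict Ω).real (halfTriangle T (i - 1) true) +
        (volume.restrict Ω).real (halfTriangle T (i - 1) true)) = 2⁻¹ := by
    field_simp
    norm_num
  rw [e]

/-- The normal strain along an edge is read off from the values of `p` at the endpoints, which both
adjacent elements share. Reversing the edge changes the sign of both factors of the inner product.
-/
theorem normalStrain_edgeCell_average (hΩ : interior (closure Ω) = Ω) (v : dispSpace Ω ΓD)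
    {p : Plane → Plane} (hvp : ∀ᵐ x ∂(volume.restrict Ω), v.1.1 x = p x)
    {A : (Fin 3 → Plane) → Plane →ᵃ[ℝ] Plane} (hA : ∀ T ∈ M.elems, EqOn p (A T) (cell T))
    (hT : T ∈ M.elems) (i : Fin 3) :
    normalStrain (T (i + 1) - T i) (affineStrain (A T)) =
      normalStrain (T (i + 1) - T i)
        (⨍ x in M.edgeCell T i, strain v x ∂(volume.restrict Ω)) := by
  have hK := M.isCompact_edgeCell T i
  have hedge : ∀ S ∈ M.elems, ∀ j, normalStrain (S (j + 1) - S j) (affineStrain (A S))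
      = inner ℝ (S (j + 1) - S j) (p (S (j + 1)) - p (S j)) := fun S hS j => by
    rw [normalStrain_affineStrain, hA S hS (vertex_mem_cell S _), hA S hS (vertex_mem_cell S _)]
  have hsub : ∀ S ∈ M.elems, ∀ j, ∀ᵐ x ∂(volume.restrict Ω), x ∈ subTriangle S j →
      strain v x = affineStrain (A S) := fun S hS j => by
    filter_upwards [strain_ae_eq M hΩ v hvp hS (hA S hS)] with x hx h
    exact hx (subTriangle_subset_cell S j h)
  have hne : volume.restrict Ω (M.edgeCell T i) ≠ 0 := fun h0 =>
    volume_restrict_halfTriangle_ne_zero M hΩ hT i false (measure_mono_null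
      ((halfTriangle_subset (Or.inl rfl) (M.convex T hT) i false).trans
        (M.subTriangle_subset_edgeCell T i)) h0)
  symm
  refine clm_setAverage_eq_of_ae _ hK.measurableSet hne (measure_restrict_ne_top Ω hK)
    (integrableOn_strainField hK _) ?_
  rcases M.edgeCell_eq_or (Or.inl rfl) T i with e | ⟨S, hS, j, hj, e⟩
  · rw [e]
    filter_upwards [hsub T hT i] with x hx h
    rw [hx h]
  · rw [e]
    filter_upwards [hsub T hT i, hsub S hS j] with x hx hx' h
    rcases h with h | h
    · rw [hx h]
    · rw [hx' h, hedge T hT, hj.1, hj.2, ← neg_sub (S (j + 1)), normalStrain_neg, hedge S hS,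
        ← neg_sub (p (S (j + 1))), inner_neg_neg]

theorem integral_eq_sum_halfTriangle (hΩ : IsOpen Ω) {g : Plane → ℝ}
    (hg : Integrable g (volume.restrict Ω)) :
    ∫ x in Ω, g x = ∑ T ∈ M.elems, ∑ i, ∑ b,
      ∫ x in halfTriangle T i b, g x ∂(volume.restrict Ω) := by
  let F : {T // T ∈ M.elems} × Fin 3 × Bool → Set Plane :=
    fun q => halfTriangle q.1.1 q.2.1 q.2.2
  have hcover : ∀ᵐ x ∂(volume.restrict Ω), x ∈ ⋃ q, F q := by
    filter_upwards [ae_restrict_mem hΩ.measurableSet] with x hx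
    obtain ⟨T, hT, i, b, h⟩ := M.exists_mem_halfTriangle (Or.inl rfl) (subset_closure hx)
    exact mem_iUnion.2 ⟨(⟨T, hT⟩, i, b), h⟩
  have hd : Pairwise (Function.onFun (AEDisjoint (volume.restrict Ω)) F) := by
    rintro ⟨⟨T, hT⟩, i, b⟩ ⟨⟨T', hT'⟩, i', b'⟩ hne
    refine Measure.absolutelyContinuous_of_le Measure.restrict_le_self ?_
    refine M.aedisjoint_halfTriangle (Or.inl rfl) hT hT' fun e => hne ?_
    simp only [Prod.mk.injEq] at e
    obtain ⟨rfl, rfl, rfl⟩ := e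
    rfl
  have h := integral_iUnion_ae (μ := volume.restrict Ω) (s := F) (f := g)
    (fun q => (isCompact_halfTriangle _ _ _).measurableSet.nullMeasurableSet) hd hg.integrableOn
  rw [Measure.restrict_eq_self_of_ae_mem hcover, tsum_fintype, Fintype.sum_prod_type] at h
  rw [h, ← Finset.sum_coe_sort M.elems]
  exact Finset.sum_congr rfl fun T _ => Fintype.sum_prod_type _

theorem norm_sq_eq_sum (hΩ : IsOpen Ω) (ε : StrainField Ω)
    {c : (Fin 3 → Plane) → Fin 3 → Bool → Voigt}
    (hc : ∀ T ∈ M.elems, ∀ i b, ∀ᵐ x ∂(volume.restrict Ω), x ∈ halfTriangle T i b →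
      ε x = c T i b) :
    ‖ε‖ ^ 2 = ∑ T ∈ M.elems, ∑ i, ∑ b,
      (volume.restrict Ω).real (halfTriangle T i b) * ‖c T i b‖ ^ 2 := by
  rw [← real_inner_self_eq_norm_sq, L2.inner_def,
    integral_eq_sum_halfTriangle M hΩ (L2.integrable_inner ε ε)]
  refine Finset.sum_congr rfl fun T hT => Finset.sum_congr rfl fun i _ =>
    Finset.sum_congr rfl fun b _ => ?_
  have e : ∀ᵐ x ∂(volume.restrict Ω), x ∈ halfTriangle T i b →
      inner ℝ (ε x) (ε x) = ‖c T i b‖ ^ 2 := by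
    filter_upwards [hc T hT i b] with x hx h
    rw [hx h, real_inner_self_eq_norm_sq]
  rw [setIntegral_congr_ae (isCompact_halfTriangle T i b).measurableSet e, setIntegral_const,
    smul_eq_mul]

/-- The constant in the bound of the squared diameter by the area of a shape regular triangle. -/
def shapeConst (κ : ℝ) : ℝ :=
  κ ^ 2 * ((volume unitTriangle).toReal / (volume (Metric.ball (0 : Plane) 1)).toReal)

/-- Compare the area of the inscribed disk with that of the triangle. -/
theorem diam_sq_le_of_shapeRegular {κ r : ℝ} {z : Plane} (hT : IsConvexCCW T) (hr : 0 < r)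
    (hball : Metric.closedBall z r ⊆ cell T) (hdiam : Metric.diam (cell T) ≤ κ * r) :
    Metric.diam (cell T) ^ 2 ≤ shapeConst κ * cross (T 1 - T 0) (T 2 - T 1) := by
  have hβ : 0 < (volume (Metric.ball (0 : Plane) 1)).toReal :=
    ENNReal.toReal_pos (Metric.measure_ball_pos volume _ one_pos).ne' measure_ball_lt_top.ne
  have hJ := cross_pos_of_isConvexCCW hT
  have h1 := measure_mono (μ := volume) hball
  rw [Measure.addHaar_closedBall _ _ hr.le, volume_cell, finrank_euclideanSpace_fin] at h1
  have h2 := ENNReal.toReal_mono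
    (ENNReal.mul_ne_top ENNReal.ofReal_ne_top volume_unitTriangle_ne_top) h1
  rw [ENNReal.toReal_mul, ENNReal.toReal_mul, ENNReal.toReal_ofReal (by positivity),
    ENNReal.toReal_ofReal (abs_nonneg _), abs_of_pos hJ] at h2
  have h3 : Metric.diam (cell T) ^ 2 ≤ κ ^ 2 * r ^ 2 := by
    rw [← mul_pow]
    exact pow_le_pow_left₀ Metric.diam_nonneg hdiam 2
  refine h3.trans ?_
  rw [shapeConst, mul_assoc]
  refine mul_le_mul_of_nonneg_left ?_ (sq_nonneg κ)
  rw [div_mul_eq_mul_div, le_div_iff₀ hβ]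
  linarith

/-- On half triangles both fields are constant, so the claim is a sum of the local tensor estimates
over the elements. -/
theorem norm_strain_sq_le (hΩo : IsOpen Ω) (hΩ : interior (closure Ω) = Ω) {κ : ℝ}
    (hM : M.ShapeRegular κ) {v : dispSpace Ω ΓD} (hv : v ∈ M.discSpace ΓD) :
    ‖strain v‖ ^ 2 ≤ 24300 * shapeConst κ ^ 4 * ‖M.smoothedStrain v‖ ^ 2 := by
  obtain ⟨p, -, ⟨hp, -⟩, hvp⟩ := hv
  choose! A hA using hp rfl
  have hE := M.edgeMesh_isPartition (Or.inl rfl) hΩo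
  have hV := M.vertexMesh_isPartition (Or.inl rfl) hΩo
  let a : (Fin 3 → Plane) → Fin 3 → Voigt :=
    fun T i => ⨍ x in M.edgeCell T i, strain v x ∂(volume.restrict Ω)
  let b : (Fin 3 → Plane) → Fin 3 → Voigt := fun T i =>
    ⨍ x in vertexCell T i, M.edgeMesh.average (strain v) x ∂(volume.restrict Ω)
  have hb : ∀ T ∈ M.elems, ∀ i, b T i = (2⁻¹ : ℝ) • (a T (i - 1) + a T i) := fun T hT i => by
    refine vertexCell_average_eq M hΩ hT i fun j => ?_
    filter_upwards [hE.average_ae_eq (strain v) (M.edgeCell_mem hT j)] with x hx h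
    exact hx (M.subTriangle_subset_edgeCell T j h)
  have n1 := norm_sq_eq_sum M hΩo (strain v) (c := fun T _ _ => affineStrain (A T))
    fun T hT i β => by
      filter_upwards [strain_ae_eq M hΩ v hvp hT (hA T hT)] with x hx h
      exact hx (subTriangle_subset_cell T i
        (halfTriangle_subset (Or.inl rfl) (M.convex T hT) i β h))
  have n2 := norm_sq_eq_sum M hΩo (M.smoothedStrain v)
    (c := fun T i β => cond β (b T (i + 1)) (b T i)) fun T hT i β => by
      cases β
      · filter_upwards [hV.average_ae_eq (M.edgeMesh.average (strain v)) (M.vertexCell_mem hT i)]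
          with x hx h
        refine hx ?_
        rw [vertexCell_eq_union]
        exact Or.inr h
      · filter_upwards [hV.average_ae_eq (M.edgeMesh.average (strain v))
          (M.vertexCell_mem hT (i + 1))] with x hx h
        refine hx ?_
        rw [vertexCell_eq_union, add_sub_cancel_right]
        exact Or.inl h
  rw [n1, n2, Finset.mul_sum]
  refine Finset.sum_le_sum fun T hT => ?_
  obtain ⟨z, r, hr, hball, hdiam⟩ := hM T hT
  have hloc := norm_sq_le_of_normalStrain_eq (h := Metric.diam (cell T)) (k := shapeConst κ)
    (fun i j => (PiLp.norm_apply_le (T (i + 1) - T i) j).trans (by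
      rw [← dist_eq_norm]
      exact Metric.dist_le_diam_of_mem (isCompact_cell T).isBounded (vertex_mem_cell T _)
        (vertex_mem_cell T _)))
    (cross_pos_of_isConvexCCW (M.convex T hT))
    (diam_sq_le_of_shapeRegular (M.convex T hT) hr hball hdiam)
    (fun i => normalStrain_edgeCell_average M hΩ v hvp hA hT i) (hb T hT)
  have hm : ∀ i β, (volume.restrict Ω).real (halfTriangle T i β)
      = (volume.restrict Ω).real (halfTriangle T 0 false) := fun i β => by
    rw [measureReal_def, measureReal_def, volume_restrict_halfTriangle M hΩ hT,
      volume_restrict_halfTriangle M hΩ hT]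
  have hm0 : 0 ≤ (volume.restrict Ω).real (halfTriangle T 0 false) := measureReal_nonneg
  have s1 : (0 : Fin 3) + 1 = 1 := rfl
  have s2 : (1 : Fin 3) + 1 = 2 := rfl
  have s3 : (2 : Fin 3) + 1 = 0 := rfl
  simp only [hm, Fin.sum_univ_three, Fintype.sum_bool, cond_true, cond_false, s1, s2, s3]
    at hloc ⊢
  -- The tensor `e` occurs on six half triangles and each `bᵢ` on two, all of equal area; the ratio
  -- 3 turns 8100 into 24300.
  have := mul_le_mul_of_nonneg_left hloc hm0
  linarith

theorem exists_normY_strain_le {D : Matrix (Fin 3) (Fin 3) ℝ} (hD : D.PosDef) (κ : ℝ) :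
    ∃ G, 0 ≤ G ∧ ∀ (Ω ΓD : Set Plane), IsOpen Ω → interior (closure Ω) = Ω →
      ∀ M : Mesh 3 Ω, M.ShapeRegular κ → ∀ v ∈ M.discSpace ΓD,
        normY D (strain v) ≤ G * normY D (M.smoothedStrain v) := by
  obtain ⟨c₁, hc₁, h₁⟩ := normY_le_norm D hD
  obtain ⟨c₂, hc₂, h₂⟩ := norm_le_normY D hD
  refine ⟨c₁ * (√(24300 * shapeConst κ ^ 4) * c₂), by positivity,
    fun Ω ΓD hΩo hΩ M hM v hv => ?_⟩
  have h := Real.le_sqrt_of_sq_le (norm_strain_sq_le M hΩo hΩ hM hv)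
  rw [Real.sqrt_mul (by positivity), Real.sqrt_sq (norm_nonneg _)] at h
  refine (h₁ Ω _).trans ?_
  rw [mul_assoc, mul_assoc]
  refine mul_le_mul_of_nonneg_left (h.trans ?_) hc₁.le
  exact mul_le_mul_of_nonneg_left (h₂ Ω _) (Real.sqrt_nonneg _)

end Stability

/-! ### The kernels and the stability constant -/

section Kernels

variable {D : Matrix (Fin 3) (Fin 3) ℝ} {Ω ΓD : Set Plane}
  {U : dispSpace Ω ΓD × StrainField Ω × StrainField Ω}

theorem pairing_zero_left (ε : StrainField Ω) : pairing 0 ε = 0 := by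
  rw [pairing_eq_inner, inner_zero_left]

/-- Test with the two differences themselves. -/
theorem eq_of_mem_kernelZ (hU : U ∈ kernelZ Ω ΓD) : U.2.1 = strain U.1 ∧ U.2.2 = strain U.1 := by
  have h1 := hU (strain U.1 - U.2.1, 0)
  have h2 := hU (0, U.2.1 - U.2.2)
  rw [formB, pairing_zero_left, add_zero, pairing_eq_inner, inner_self_eq_zero, sub_eq_zero] at h1
  rw [formB, pairing_zero_left, zero_add, pairing_eq_inner, inner_self_eq_zero, sub_eq_zero] at h2
  exact ⟨h1.symm, h2.symm.trans h1.symm⟩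

theorem eq_of_mem_discKernelZ {n : ℕ} [NeZero n] {M : Mesh n Ω} (h1 : M.edgeMesh.IsPartition Ω)
    (h2 : M.vertexMesh.IsPartition Ω) (hU : U ∈ discKernelZ M ΓD) :
    U.2.1 = M.edgeMesh.average (strain U.1) ∧ U.2.2 = M.smoothedStrain U.1 := by
  have e1 : U.2.1 = M.edgeMesh.average (strain U.1) := by
    refine h1.eq_average hU.1.2.1 fun τ hτ => ?_
    have h := hU.2 (τ, 0) hτ Cells.zero_mem_pwConst
    rwa [formB, pairing_zero_left, add_zero] at h
  have e2 : U.2.2 = M.vertexMesh.average U.2.1 := by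
    refine h2.eq_average hU.1.2.2 fun τ hτ => ?_
    have h := hU.2 (0, τ) Cells.zero_mem_pwConst hτ
    rwa [formB, pairing_zero_left, zero_add] at h
  refine ⟨e1, ?_⟩
  rw [e2, e1]
  rfl

theorem normPi_le_sqrt_mul {G : ℝ} (h1 : normY D (strain U.1) ≤ G * normY D U.2.2)
    (h2 : normY D U.2.1 ≤ G * normY D U.2.2) :
    normPi D U ≤ √(2 * G ^ 2 + 1) * seminormPi D U := by
  have n0 : 0 ≤ normY D U.2.2 := normY_nonneg _
  rw [seminormPi, ← Real.sqrt_sq n0, ← Real.sqrt_mul (by positivity), normPi]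
  refine Real.sqrt_le_sqrt ?_
  have q1 := pow_le_pow_left₀ (normY_nonneg _) h1 2
  have q2 := pow_le_pow_left₀ (normY_nonneg _) h2 2
  rw [mul_pow] at q1 q2
  linarith

theorem exists_stability_constant (hD : D.PosDef) (κ : ℝ) :
    ∃ α : ℝ, 0 < α ∧ ∀ (Ω ΓD : Set Plane), IsOpen Ω → interior (closure Ω) = Ω →
      ∀ M : Mesh 3 Ω, M.ShapeRegular κ → StabilityAssumption D M ΓD α := by
  obtain ⟨G, hG, h⟩ := exists_normY_strain_le hD κ
  have hpos : 0 < √(2 * (G + 1) ^ 2 + 1) := Real.sqrt_pos.2 (by positivity)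
  -- The shift to `G + 1` gives a factor of at least one, as needed on `Z`, where all three strains
  -- coincide.
  refine ⟨(√(2 * (G + 1) ^ 2 + 1))⁻¹, inv_pos.2 hpos, fun Ω ΓD hΩo hΩ M hM U hU => ?_⟩
  rw [inv_mul_le_iff₀ hpos]
  have n0 : 0 ≤ normY D U.2.2 := normY_nonneg _
  rcases hU with hU | hU
  · obtain ⟨e1, e2⟩ := eq_of_mem_kernelZ hU
    have h0 : normY D (strain U.1) ≤ (G + 1) * normY D U.2.2 := by
      rw [e2] at n0 ⊢
      nlinarith
    refine normPi_le_sqrt_mul h0 ?_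
    rw [e1]
    exact h0
  · have hE := M.edgeMesh_isPartition (Or.inl rfl) hΩo
    obtain ⟨e1, e2⟩ := eq_of_mem_discKernelZ hE (M.vertexMesh_isPartition (Or.inl rfl) hΩo) hU
    have h0 : normY D (strain U.1) ≤ (G + 1) * normY D U.2.2 := by
      have := h Ω ΓD hΩo hΩ M hM U.1 hU.1.1
      rw [← e2] at this
      linarith
    refine normPi_le_sqrt_mul h0 ?_
    rw [e1]
    exact (hE.normY_average_le hD _).trans h0

end Kernels

end SSE

end

open SSE in
/-- Error estimate for the strain-smoothed element method. -/
theorem mainTheorem1 (D : Matrix (Fin 3) (Fin 3) ℝ) (hD : D.PosDef) :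
    -- Triangles: the stability assumption holds, with a constant that depends only on `D` and on
    -- the shape regularity of the mesh.
    (∀ κ : ℝ, ∃ α : ℝ, 0 < α ∧ ∀ (Ω ΓD : Set Plane), IsElasticBody Ω ΓD →
      ∀ M : Mesh 3 Ω, M.ShapeRegular κ → StabilityAssumption D M ΓD α) ∧
    -- Triangles and quadrilaterals: the error estimate.
    (∀ (n : ℕ) [NeZero n], n = 3 ∨ n = 4 → ∀ (Ω ΓD : Set Plane), IsElasticBody Ω ΓD →
      ∀ M : Mesh n Ω,
        (∀ α : ℝ, 0 < α → StabilityAssumption D M ΓD α →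
          ∀ (f : dispSpace Ω ΓD →L[ℝ] ℝ) (u uh : dispSpace Ω ΓD),
            SolvesWeak D f u → SolvesSSE D M f uh → ErrorEstimate D M u uh (2 / α)) ∧
        (∃ C : ℝ, 0 < C ∧
          ∀ (f : dispSpace Ω ΓD →L[ℝ] ℝ) (u uh : dispSpace Ω ΓD),
            SolvesWeak D f u → SolvesSSE D M f uh → ErrorEstimate D M u uh C)) := by
  refine ⟨fun κ => ?_, fun n _ hn Ω ΓD hΩ M => ?_⟩
  · obtain ⟨α, hα, h⟩ := exists_stability_constant hD κ
    exact ⟨α, hα, fun Ω ΓD hΩ M hM => h Ω ΓD hΩ.isOpen hΩ.no_slit M hM⟩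
  · have h1 := M.edgeMesh_isPartition hn hΩ.isOpen
    have h2 := M.vertexMesh_isPartition hn hΩ.isOpen
    refine ⟨fun α hα hs f u uh hu huh => errorEstimate_of_stability M hD h1 h2 hα hs hu huh, ?_⟩
    obtain ⟨C, hC, hlift⟩ := exists_lift M hD ΓD
    exact ⟨C, hC, fun f u uh hu huh => errorEstimate_of_lift M hD h1 h2 hC.le hlift hu huh⟩
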